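/- **Setting.** Values are natural numbers ($0=\mathsf{null}$); locations are $\mathit{Lock}$, $q.\mathit{locked}$, $q.\mathit{next}$ for each value $q$, and a location $f$ used only for fences; all are initially $0$. Let $a\neq b$ be nonzero values (node addresses). The MCS-lock client has two threads; the first takes $n=a$, the second $n=b$, and each runs $\mathit{lock}(n);\mathit{unlock}(n)$, where - $\mathit{lock}(n)$: $n.\mathit{locked}:=1$; $n.\mathit{next}:=\mathsf{null}$; $\big[\mathsf{fence}^{\mathsf{rel}}\big]$; $\mathit{pred}:=\mathsf{SWAP}^{\mathsf{acqrel}}(\mathit{Lock},n)$; if $\mathit{pred}\neq\mathsf{null}$ then $\{\mathit{pred}.\mathit{next}:=n$; while $n.\mathit{locked}=1$ do $\{\}$; $\mathsf{fence}^{\mathsf{acq}}\}$. - $\mathit{unlock}(n)$: $\mathsf{fence}^{\mathsf{rel}}$; $\mathit{succ}:=n.\mathit{next}$; $\mathsf{fence}^{\mathsf{acq}}$; if $\mathit{succ}=\mathsf{null}$ then $\{$if $\mathsf{CAS}^{\mathsf{acqrel}}(\mathit{Lock},n,\mathsf{null})$ succeeds then return; repeat $\mathit{succ}:=n.\mathit{next}$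 until $\mathit{succ}\neq\mathsf{null}\}$; $\mathit{succ}.\mathit{locked}:=0$. Unannotated accesses are relaxed, the CAS is strong, and a failed $\mathsf{CAS}^{\mathsf{acqrel}}$ is an acquire read. The bracketed fence is the one missing in the published algorithm. A *behavior* $\beta$ assigns to each thread the finite or infinite sequence of labels (reads $\mathtt R$, writes $\mathtt W$, read-modify-writes $\mathtt{RMW}$, fences $\mathtt F$) of its steps; it is *finite* if both sequences are. At program level a read may return any value. A run of the interleaving semantics is *thread-fair* if it is finite or if every thread that is enabled from some index on is scheduled at or after that index; a behavior is thread-fair if a thread-fair run induces it. An *execution graph* $G=(E,\mathit{rf},\mathit{mo})$ consists of a well-formed set $E$ of events (one initialization write per location; each thread's events numbered consecutively from $0$, with one label per number), a reads-from relation $\mathit{rf}$ giving each read exactly one write of the same location and value, and a modification order $\mathit{mo}$, a disjoint union of strict total orders on the writes to each location (an RMW is both a read and a write). Let $\mathit{po}$ be program order (initialization events first), $\mathit{fr}=(\mathit{rf}^{-1};\mathit{mo})\setminus\mathrm{id}$, and for a relation $R$ let $R|_{\mathrm{loc}}$ be its restriction to pairs of events on the same location and $R|_{\neq\mathrm{loc}}=R\setminus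 R|_{\mathrm{loc}}$. $G$ is *fair* if every event has only finitely many $\mathit{mo}$- and $\mathit{fr}$-predecessors. Consistency of $G$: - SC: $(\mathit{po}\cup\mathit{rf}\cup\mathit{mo}\cup\mathit{fr})^+$ is irreflexive. - TSO: $(\mathit{ppo}\cup\mathit{rfe}\cup\mathit{mo}\cup\mathit{fr})^+$ and $(\mathit{po}|_{\mathrm{loc}}\cup\mathit{rf}\cup\mathit{mo}\cup\mathit{fr})^+$ are irreflexive, where $\mathit{rfe}=\mathit{rf}\setminus\mathit{po}$ and $\mathit{ppo}$ is $\mathit{po}$ without the pairs from a non-RMW write to a non-RMW read. - RA: $\big((\mathit{po}\cup\mathit{rf})^+|_{\mathrm{loc}}\cup\mathit{rf}\cup\mathit{mo}\cup\mathit{fr}\big)^+$ is irreflexive. - RC11 (Lahav et al., PLDI 2017, with each RMW a single event): $\mathit{hb};\mathit{eco}^?$, $\mathit{eco}$, $\mathit{psc}^+$ and $(\mathit{po}\cup\mathit{rf})^+$ are irreflexive, where $\mathit{eco}=(\mathit{rf}\cup\mathit{mo}\cup\mathit{fr})^+$, $\mathit{hb}=(\mathit{po}\cup\mathit{sw})^+$,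 $\mathit{sw}=[E^{\sqsupseteq\mathsf{rel}}];([\mathtt F];\mathit{po})^?;\mathit{rs};\mathit{rf};[\mathtt R^{\sqsupseteq\mathsf{rlx}}];(\mathit{po};[\mathtt F])^?;[E^{\sqsupseteq\mathsf{acq}}]$, $\mathit{rs}=[\mathtt W];(\mathit{po}|_{\mathrm{loc}})^?;[\mathtt W^{\sqsupseteq\mathsf{rlx}}];(\mathit{rf};[\mathtt{RMW}])^*$, and $\mathit{psc}=([E^{\mathsf{sc}}]\cup[\mathtt F^{\mathsf{sc}}];\mathit{hb}^?);\mathit{scb};([E^{\mathsf{sc}}]\cup\mathit{hb}^?;[\mathtt F^{\mathsf{sc}}])\ \cup\ [\mathtt F^{\mathsf{sc}}];(\mathit{hb}\cup\mathit{hb};\mathit{eco};\mathit{hb});[\mathtt F^{\mathsf{sc}}]$ with $\mathit{scb}=\mathit{po}\cup\mathit{po}|_{\neq\mathrm{loc}};\mathit{hb};\mathit{po}|_{\neq\mathrm{loc}}\cup\mathit{hb}|_{\mathrm{loc}}\cup\mathit{mo}\cup\mathit{fr}$. For $X\in\{\mathrm{SC},\mathrm{TSO},\mathrm{RA},\mathrm{RC11}\}$,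 a behavior $\beta$ is allowed by *fair $X$* if the events of $\beta$, together with the initialization events, are the event set of some fair $X$-consistent execution graph. In SC, TSO and RA, labels have no modes and no fences: modes are dropped, and a fence is either an RMW of $f$ writing back the value it reads, or no operation. **Theorem.** 1. With the bracketed $\mathsf{fence}^{\mathsf{rel}}$ present, every thread-fair behavior of the client that is allowed by fair SC, by fair TSO, by fair RA (under either treatment of fences), or by fair RC11 is finite. 2. Without the bracketed fence, some thread-fair behavior of the client that is allowed by fair RC11 is infinite. -/

import Mathlib

namespace FairMem

/-! ### Values, locations, threads, event labels -/

/-- Values.  `0` is the initial value of every location and also plays the role of `null`;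
the address of a queue node is a nonzero value. -/
abbrev Val : Type := ℕ

/-- Shared locations: the lock variable `Lock`, the fields `q.locked` and `q.next` of the queue
node with address `q`, and a distinguished location used for nothing but fences. -/
inductive Loc : Type
  | lock
  | locked (q : Val)
  | next (q : Val)
  | fenceLoc

/-- The two threads. -/
abbrev Tid : Type := Fin 2

/-- Event labels: reads, writes and read-modify-writes carrying an access annotation from `Acc`,
and fences carrying an annotation from `Fen`. -/
inductive Lab (Acc Fen : Type) : Type
  | R (o : Acc) (x : Loc) (v : Val)
  | W (o : Acc) (x : Loc) (v : Val)
  | U (o : Acc) (x : Loc) (vr vw : Val)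
  | F (o : Fen)

/-- Plain labels: no access modes and no fences. -/
abbrev ELab : Type := Lab Unit Empty

/-- C11 access modes (memory orders). -/
inductive Mode : Type
  | na | rlx | acq | rel | acqrel | sc

/-- Labels with C11 access modes and C11 fences. -/
abbrev CLab : Type := Lab Mode Mode

namespace Lab

variable {Acc Fen : Type}

def loc : Lab Acc Fen → Option Loc
  | R _ x _ => some x
  | W _ x _ => some x
  | U _ x _ _ => some x
  | F _ => none

def valr : Lab Acc Fen → Option Val
  | R _ _ v => some v
  | W _ _ _ => none
  | U _ _ v _ => some v
  | F _ => none

def valw : Lab Acc Fen → Option Val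
  | R _ _ _ => none
  | W _ _ v => some v
  | U _ _ _ v => some v
  | F _ => none

end Lab

/-! ### Labeled transition systems and programs -/

/-- Labeled transition systems with observable labels in `A` and no silent labels. -/
structure LTS (A : Type) where
  Q : Type
  init : Q
  step : Q → A → Q → Prop

/-- `μ`, a finite or infinite sequence of transitions (source, label, target), is a run. -/
structure LTS.IsRun {A : Type} (S : LTS A) (μ : Stream'.Seq (S.Q × A × S.Q)) : Prop where
  trans : ∀ k t, μ.get? k = some t → S.step t.1 t.2.1 t.2.2
  start : ∀ t, μ.get? 0 = some t → t.1 = S.init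
  chain : ∀ k t t', μ.get? k = some t → μ.get? (k + 1) = some t' → t.2.2 = t'.1

/-- A concurrent program: one sequential program per thread. -/
abbrev Program (Acc Fen : Type) : Type 1 := Tid → LTS (Lab Acc Fen)

/-- The interleaving semantics of a concurrent program. -/
def Program.lts {Acc Fen : Type} (P : Program Acc Fen) : LTS (Tid × Lab Acc Fen) where
  Q := ∀ τ, (P τ).Q
  init := fun τ => (P τ).init
  step := fun p σ p' =>
    (P σ.1).step (p σ.1) σ.2 (p' σ.1) ∧ ∀ π, π ≠ σ.1 → p' π = p π

/-- Thread `τ` is enabled in the state `p`. -/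
def Program.Enabled {Acc Fen : Type} (P : Program Acc Fen) (τ : Tid) (p : P.lts.Q) : Prop :=
  ∃ l p', P.lts.step p (τ, l) p'

/-- A run is thread-fair if it is finite or every thread that is continuously enabled from some
index on is scheduled at or after that index. -/
def Program.ThreadFair {Acc Fen : Type} (P : Program Acc Fen)
    (μ : Stream'.Seq (P.lts.Q × (Tid × Lab Acc Fen) × P.lts.Q)) : Prop :=
  μ.Terminates ∨
    ∀ τ k, (∀ j, k ≤ j → ∀ t, μ.get? j = some t → P.Enabled τ t.1) →
      ∃ j, k ≤ j ∧ ∃ t, μ.get? j = some t ∧ t.2.1.1 = τ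

/-- Behaviors: a finite or infinite sequential trace for every thread. -/
abbrev Behavior (Acc Fen : Type) : Type := Tid → Stream'.Seq (Lab Acc Fen)

/-- A behavior is finite if it assigns a finite trace to every thread. -/
def Behavior.Finite {Acc Fen : Type} (β : Behavior Acc Fen) : Prop :=
  ∀ τ, (β τ).Terminates

/-- `β` is the behavior induced by the concurrent trace `ρ`: the `k`-th label of `β τ` is the label
of the position of `ρ` that belongs to `τ` and has exactly `k` positions of `τ` before it. -/
def Induces {Acc Fen : Type} (ρ : Stream'.Seq (Tid × Lab Acc Fen)) (β : Behavior Acc Fen) :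
    Prop :=
  ∀ τ k l, (β τ).get? k = some l ↔
    ∃ j, ρ.get? j = some (τ, l) ∧ {i | i < j ∧ ∃ l', ρ.get? i = some (τ, l')}.ncard = k

/-- The thread-fair behaviors of a program. -/
def Program.behTF {Acc Fen : Type} (P : Program Acc Fen) : Set (Behavior Acc Fen) :=
  {β | ∃ μ, P.lts.IsRun μ ∧ P.ThreadFair μ ∧ Induces (μ.map fun t => t.2.1) β}

/-! ### Events and execution graphs -/

/-- Events: the initialization write of `0` to `x`, and the event with serial number `k` and
label `l` in thread `τ`. -/
inductive Event (Acc Fen : Type) : Type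
  | init (x : Loc)
  | act (k : ℕ) (τ : Tid) (l : Lab Acc Fen)

namespace Event

variable {Acc Fen : Type}

def loc : Event Acc Fen → Option Loc
  | init x => some x
  | act _ _ l => l.loc

def valr : Event Acc Fen → Option Val
  | init _ => none
  | act _ _ l => l.valr

def valw : Event Acc Fen → Option Val
  | init _ => some 0
  | act _ _ l => l.valw

/-- Reads, including read-modify-writes. -/
def IsR : Event Acc Fen → Prop
  | act _ _ (.R _ _ _) => True
  | act _ _ (.U _ _ _ _) => True
  | _ => False

/-- Writes, including read-modify-writes and initialization events. -/
def IsW : Event Acc Fen → Prop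
  | init _ => True
  | act _ _ (.W _ _ _) => True
  | act _ _ (.U _ _ _ _) => True
  | _ => False

/-- Read-modify-writes. -/
def IsU : Event Acc Fen → Prop
  | act _ _ (.U _ _ _ _) => True
  | _ => False

/-- Fences. -/
def IsF : Event Acc Fen → Prop
  | act _ _ (.F _) => True
  | _ => False

/-- The sequenced-before order. -/
def SB : Event Acc Fen → Event Acc Fen → Prop
  | init _, act _ _ _ => True
  | act j τ _, act k π _ => τ = π ∧ j < k
  | _, _ => False

end Event

/-- The set of events extracted from a behavior. -/
def Behavior.events {Acc Fen : Type} (β : Behavior Acc Fen) : Set (Event Acc Fen) :=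
  {e | (∃ x, e = .init x) ∨ ∃ k τ l, (β τ).get? k = some l ∧ e = .act k τ l}

/-- Execution graphs. -/
structure ExecGraph (Acc Fen : Type) where
  /-- the events -/
  E : Set (Event Acc Fen)
  /-- reads-from -/
  rf : Event Acc Fen → Event Acc Fen → Prop
  /-- modification order -/
  mo : Event Acc Fen → Event Acc Fen → Prop
  init_mem : ∀ x, .init x ∈ E
  sn_unique : ∀ k τ l l', .act k τ l ∈ E → .act k τ l' ∈ E → l = l'
  sn_closed : ∀ k τ l, .act k τ l ∈ E → ∀ j, j < k → ∃ l', .act j τ l' ∈ E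
  rf_dom : ∀ w r, rf w r → w ∈ E ∧ r ∈ E ∧ w.IsW ∧ r.IsR ∧ w.loc = r.loc ∧ w.valw = r.valr
  rf_functional : ∀ w w' r, rf w r → rf w' r → w = w'
  rf_total : ∀ r ∈ E, r.IsR → ∃ w, rf w r
  mo_dom : ∀ w w', mo w w' → w ∈ E ∧ w' ∈ E ∧ w.IsW ∧ w'.IsW ∧ w.loc = w'.loc
  mo_irrefl : ∀ w, ¬ mo w w
  mo_trans : ∀ w₁ w₂ w₃, mo w₁ w₂ → mo w₂ w₃ → mo w₁ w₃
  mo_total : ∀ w ∈ E, ∀ w' ∈ E, w.IsW → w'.IsW → w.loc = w'.loc → w ≠ w' → mo w w' ∨ mo w' w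

/-- The identity relation on a set of events. -/
def idOn {α : Type} (S : α → Prop) (x y : α) : Prop := x = y ∧ S x

/-- Restriction of a relation to pairs of events of the same location. -/
def sameLoc {Acc Fen : Type} (r : Event Acc Fen → Event Acc Fen → Prop)
    (e e' : Event Acc Fen) : Prop :=
  r e e' ∧ ∃ x, e.loc = some x ∧ e'.loc = some x

/-- The pairs of a relation that are not on the same location. -/
def diffLoc {Acc Fen : Type} (r : Event Acc Fen → Event Acc Fen → Prop)
    (e e' : Event Acc Fen) : Prop :=
  r e e' ∧ ¬ ∃ x, e.loc = some x ∧ e'.loc = some x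

/-- Irreflexivity of a relation. -/
def Irrefl {α : Type} (r : α → α → Prop) : Prop := ∀ x, ¬ r x x

namespace ExecGraph

open Relation

section Common

variable {Acc Fen : Type} (G : ExecGraph Acc Fen)

/-- Program order. -/
def po (e e' : Event Acc Fen) : Prop := e ∈ G.E ∧ e' ∈ G.E ∧ e.SB e'

/-- From-read: `rf⁻¹ ; mo` minus the identity. -/
def fr (r w : Event Acc Fen) : Prop := (∃ w', G.rf w' r ∧ G.mo w' w) ∧ r ≠ w

/-- Fairness: `mo` and `fr` are prefix-finite. -/
def Fair : Prop :=
  (∀ e ∈ G.E, {e' | G.mo e' e}.Finite) ∧ (∀ e ∈ G.E, {e' | G.fr e' e}.Finite)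

end Common

section Plain

variable (G : ExecGraph Unit Empty)

/-- SC consistency. -/
def SC : Prop :=
  Irrefl (TransGen fun e e' => G.po e e' ∨ G.rf e e' ∨ G.mo e e' ∨ G.fr e e')

/-- External reads-from. -/
def rfe (e e' : Event Unit Empty) : Prop := G.rf e e' ∧ ¬ G.po e e'

/-- Preserved program order of TSO. -/
def ppo (e e' : Event Unit Empty) : Prop :=
  G.po e e' ∧ ¬ ((e.IsW ∧ ¬ e.IsU) ∧ (e'.IsR ∧ ¬ e'.IsU))

/-- TSO consistency: irreflexivity of TSO-happens-before and SC per location. -/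
def TSO : Prop :=
  Irrefl (TransGen fun e e' => G.ppo e e' ∨ G.rfe e e' ∨ G.mo e e' ∨ G.fr e e') ∧
  Irrefl (TransGen fun e e' => sameLoc G.po e e' ∨ G.rf e e' ∨ G.mo e e' ∨ G.fr e e')

/-- RA-happens-before. -/
def hbRA : Event Unit Empty → Event Unit Empty → Prop :=
  TransGen fun e e' => G.po e e' ∨ G.rf e e'

/-- RA consistency. -/
def RA : Prop :=
  Irrefl (TransGen fun e e' => sameLoc G.hbRA e e' ∨ G.rf e e' ∨ G.mo e e' ∨ G.fr e e')

end Plain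

end ExecGraph

/-! ### RC11 -/

/-- Modes at least as strong as `rlx`. -/
def Mode.AtLeastRlx (o : Mode) : Prop := o ≠ .na

/-- Modes at least as strong as `acq`. -/
def Mode.AtLeastAcq (o : Mode) : Prop := o = .acq ∨ o = .acqrel ∨ o = .sc

/-- Modes at least as strong as `rel`. -/
def Mode.AtLeastRel (o : Mode) : Prop := o = .rel ∨ o = .acqrel ∨ o = .sc

/-- The mode of an event; initialization writes are non-atomic. -/
def Event.mode : Event Mode Mode → Mode
  | .init _ => .na
  | .act _ _ (.R o _ _) => o
  | .act _ _ (.W o _ _) => o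
  | .act _ _ (.U o _ _ _) => o
  | .act _ _ (.F o) => o

namespace ExecGraph

open Relation

section RC11

variable (G : ExecGraph Mode Mode)

/-- Release sequences: `[W] ; (po|loc)? ; [W⊒rlx] ; (rf ; [RMW])*`. -/
def rs : Event Mode Mode → Event Mode Mode → Prop :=
  Comp (idOn Event.IsW) <| Comp (ReflGen (sameLoc G.po)) <|
    Comp (idOn fun e => e.IsW ∧ e.mode.AtLeastRlx) <|
      ReflTransGen (Comp G.rf (idOn Event.IsU))

/-- Synchronizes-with:
`[E⊒rel] ; ([F] ; po)? ; rs ; rf ; [R⊒rlx] ; (po ; [F])? ; [E⊒acq]`. -/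
def sw : Event Mode Mode → Event Mode Mode → Prop :=
  Comp (idOn fun e => e.mode.AtLeastRel) <| Comp (ReflGen (Comp (idOn Event.IsF) G.po)) <|
    Comp G.rs <| Comp G.rf <| Comp (idOn fun e => e.IsR ∧ e.mode.AtLeastRlx) <|
      Comp (ReflGen (Comp G.po (idOn Event.IsF))) (idOn fun e => e.mode.AtLeastAcq)

/-- Happens-before: `(po ∪ sw)⁺`. -/
def hb : Event Mode Mode → Event Mode Mode → Prop :=
  TransGen fun e e' => G.po e e' ∨ G.sw e e'

/-- Extended coherence order: `(rf ∪ mo ∪ fr)⁺`. -/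
def eco : Event Mode Mode → Event Mode Mode → Prop :=
  TransGen fun e e' => G.rf e e' ∨ G.mo e e' ∨ G.fr e e'

/-- SC-before: `po ∪ po|≠loc ; hb ; po|≠loc ∪ hb|loc ∪ mo ∪ fr`. -/
def scb (e e' : Event Mode Mode) : Prop :=
  G.po e e' ∨ Comp (diffLoc G.po) (Comp G.hb (diffLoc G.po)) e e' ∨ sameLoc G.hb e e' ∨
    G.mo e e' ∨ G.fr e e'

/-- `[Esc] ∪ [Fsc] ; hb?`. -/
def scLeft (e e' : Event Mode Mode) : Prop :=
  idOn (fun d => d.mode = .sc) e e' ∨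
    Comp (idOn fun d => d.IsF ∧ d.mode = .sc) (ReflGen G.hb) e e'

/-- `[Esc] ∪ hb? ; [Fsc]`. -/
def scRight (e e' : Event Mode Mode) : Prop :=
  idOn (fun d => d.mode = .sc) e e' ∨
    Comp (ReflGen G.hb) (idOn fun d => d.IsF ∧ d.mode = .sc) e e'

/-- `([Esc] ∪ [Fsc] ; hb?) ; scb ; ([Esc] ∪ hb? ; [Fsc])`. -/
def pscBase : Event Mode Mode → Event Mode Mode → Prop :=
  Comp G.scLeft (Comp G.scb G.scRight)

/-- `[Fsc] ; (hb ∪ hb ; eco ; hb) ; [Fsc]`. -/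
def pscF : Event Mode Mode → Event Mode Mode → Prop :=
  Comp (idOn fun d => d.IsF ∧ d.mode = .sc) <|
    Comp (fun e e' => G.hb e e' ∨ Comp G.hb (Comp G.eco G.hb) e e')
      (idOn fun d => d.IsF ∧ d.mode = .sc)

/-- RC11 consistency, with a read-modify-write represented by a single event.  With single events,
atomicity (`fr ; mo` irreflexive), and the coherence of the two halves of a read-modify-write with
each other, are expressed by the irreflexivity of `eco`. -/
structure RC11 : Prop where
  coherence : Irrefl (Comp G.hb (ReflGen G.eco))
  atomicity : Irrefl G.eco
  sc_order : Irrefl (TransGen fun e e' => G.pscBase e e' ∨ G.pscF e e')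
  no_thin_air : Irrefl (TransGen fun e e' => G.po e e' ∨ G.rf e e')

end RC11

end ExecGraph

/-- The behaviors allowed by the declarative memory system `{G | C G}`. -/
def behDecl {Acc Fen : Type} (C : ExecGraph Acc Fen → Prop) : Set (Behavior Acc Fen) :=
  {β | ∃ G : ExecGraph Acc Fen, C G ∧ β.events = G.E}

/-! ### The MCS lock client -/

/-- Program points of a thread that allocates a node `n`, calls `lock(Lock, n)` and then
`unlock(Lock, n)`; local variables that are still needed are recorded in the state. -/
inductive PC : Type
  /-- `n.locked := 1` -/
  | setLocked
  /-- `n.next := null` -/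
  | clearNext
  /-- `fence^rel` (the fence in question) -/
  | lockFenceRel
  /-- `pred := SWAP^acqrel(Lock, n)` -/
  | swap
  /-- `pred.next := n` -/
  | link (pred : Val)
  /-- `while n.locked = 1 {}` -/
  | spin
  /-- `fence^acq` -/
  | lockFenceAcq
  /-- `unlock`: `fence^rel` -/
  | unlockFenceRel
  /-- `succ := n.next` -/
  | readNext
  /-- `fence^acq` -/
  | unlockFenceAcq (succ : Val)
  /-- `if CAS^acqrel(Lock, n, null) then return` -/
  | cas
  /-- `repeat succ := n.next until succ ≠ null` -/
  | awaitNext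
  /-- `succ.locked := 0` -/
  | handOver (succ : Val)
  | done

/-- The steps of such a thread; `fenced` says whether the release fence in `lock` is present.
Accesses without annotation are relaxed.  The CAS is strong; a failed `CAS^acqrel` is an acquire
read. -/
inductive Step (fenced : Bool) (n : Val) : PC → CLab → PC → Prop
  | setLocked : Step fenced n .setLocked (.W .rlx (.locked n) 1) .clearNext
  | clearNext : Step fenced n .clearNext (.W .rlx (.next n) 0)
      (if fenced then .lockFenceRel else .swap)
  | lockFenceRel : Step fenced n .lockFenceRel (.F .rel) .swap
  | swap (pred : Val) : Step fenced n .swap (.U .acqrel .lock pred n)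
      (if pred = 0 then .unlockFenceRel else .link pred)
  | link (pred : Val) : Step fenced n (.link pred) (.W .rlx (.next pred) n) .spin
  | spin (v : Val) : Step fenced n .spin (.R .rlx (.locked n) v)
      (if v = 1 then .spin else .lockFenceAcq)
  | lockFenceAcq : Step fenced n .lockFenceAcq (.F .acq) .unlockFenceRel
  | unlockFenceRel : Step fenced n .unlockFenceRel (.F .rel) .readNext
  | readNext (succ : Val) : Step fenced n .readNext (.R .rlx (.next n) succ) (.unlockFenceAcq succ)
  | unlockFenceAcq (succ : Val) : Step fenced n (.unlockFenceAcq succ) (.F .acq)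
      (if succ = 0 then .cas else .handOver succ)
  | casSuccess : Step fenced n .cas (.U .acqrel .lock n 0) .done
  | casFail (v : Val) (hv : v ≠ n) : Step fenced n .cas (.R .acq .lock v) .awaitNext
  | awaitNext (succ : Val) : Step fenced n .awaitNext (.R .rlx (.next n) succ)
      (if succ = 0 then .awaitNext else .handOver succ)
  | handOver (succ : Val) : Step fenced n (.handOver succ) (.W .rlx (.locked succ) 0) .done

/-- The two-thread client: thread 0 allocates its node at address `a`, thread 1 at address `b`;
each locks and then unlocks once. -/
def mcsClient (fenced : Bool) (a b : Val) : Program Mode Mode := fun τ =>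
  { Q := PC, init := .setLocked, step := Step fenced (if τ = 0 then a else b) }

/-- The two readings of a fence in a memory model whose labels have no fences: a read-modify-write
of the distinguished location that writes back the value it reads, or no operation at all. -/
inductive FenceReading : Type
  | rmw
  | nop

/-- Forget the access mode of a memory access; undefined on fences. -/
def CLab.forget : CLab → Option ELab
  | .R _ x v => some (.R () x v)
  | .W _ x v => some (.W () x v)
  | .U _ x vr vw => some (.U () x vr vw)
  | .F _ => none

/-- A sequential program without modes and fences obtained from one with modes and fences.  Under
the reading `nop`, the fences that precede a memory access are passed silently together with that
access. -/
def plainLTS : FenceReading → LTS CLab → LTS ELab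
  | .rmw, S =>
    { Q := S.Q
      init := S.init
      step := fun q l q' =>
        (∃ c, S.step q c q' ∧ c.forget = some l) ∨
          ∃ o v, S.step q (.F o) q' ∧ l = .U () .fenceLoc v v }
  | .nop, S =>
    { Q := S.Q
      init := S.init
      step := fun q l q' =>
        ∃ q₁ c, Relation.ReflTransGen (fun p p' => ∃ o, S.step p (.F o) p') q q₁ ∧
          S.step q₁ c q' ∧ c.forget = some l }

/-- The plain version of a concurrent program. -/
def Program.plain (i : FenceReading) (P : Program Mode Mode) : Program Unit Empty :=
  fun τ => plainLTS i (P τ)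

end FairMem

/-! Finiteness. Every step of a thread except an idle loop iteration lowers a rank, so an infinite
trace eventually repeats one loop forever, always reading the same value. It then suffices to find
one write to the location being read that is `mo`-after the source of each of these reads: it has
infinitely many `fr`-predecessors, contradicting fairness (`ClientGraph.not_infinite_fr`).
Happens-before and coherence provide the `mo` edge.

Waiting for a successor: the CAS failed, so by coherence and atomicity the other swap reads from
this one (`ClientGraph.rf_of_casFail`). The other thread therefore links its node, and the
synchronizing swaps put the clearing of `next` before the link. All reads of `null` are thus
`fr`-before the link (`ClientGraph.not_await_forever`).

Spinning: the swap read the other node, so the other swap read `null`, and the other thread neither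
spins nor, by the previous case, waits forever. Its CAS cannot succeed, because a write is read by
at most one read-modify-write. So it reads the link and hands over. If `locked := 1` happens before
this hand-over, all spinning reads are `fr`-before it (`ClientGraph.not_spin_forever`).

Only that last happens-before edge needs the bracketed fence. Under RC11 it comes either from the
release fence before the link and the acquire fence after the read of `next`, or from a failed CAS,
which acquires from the lock. In SC, TSO and RA every `rf` edge may be used. The interface `Sync`
records what is needed, and is established for RA, SC, TSO and RC11 separately.

Infinite behavior. Without the fence nothing orders `b.locked := 1` before the hand-over `b.locked
:= 0`, so the hand-over may come first in `mo`. Spinning then reads the `mo`-maximal write forever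
and creates no `fr` edges, so the graph is fair. Its consistency follows from two numerical ranks
and an upper bound of happens-before. -/

namespace FairMem

/-! ### Local states of the threads along a thread-fair run -/

open Classical in
/-- Every thread of a thread-fair behavior runs through a sequence of local states; if the behavior
is infinite, a thread can halt only in a state without outgoing steps. -/
theorem Program.exists_local_states {Acc Fen : Type} {P : Program Acc Fen}
    {β : Behavior Acc Fen} (h : β ∈ P.behTF) :
    β.Finite ∨ ∀ τ, ∃ s : ℕ → (P τ).Q, s 0 = (P τ).init ∧
      (∀ k l, (β τ).get? k = some l → (P τ).step (s k) l (s (k + 1))) ∧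
      ∀ k, (∀ i < k, (β τ).get? i ≠ none) → (β τ).get? k = none →
        ∀ l q, ¬ (P τ).step (s k) l q := by
  obtain ⟨μ, hrun, hfair, hind⟩ := h
  have hmap : ∀ j x, (μ.map fun t => t.2.1).get? j = some x ↔
      ∃ t, μ.get? j = some t ∧ t.2.1 = x := by
    intro j x
    rw [Stream'.Seq.map_get?]
    simp
  have hcount : ∀ τ j, {i | i < j ∧ ∃ l', (μ.map fun t => t.2.1).get? i = some (τ, l')}.ncard =
      Nat.count (fun i => ∃ t, μ.get? i = some t ∧ t.2.1.1 = τ) j := by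
    intro τ j
    rw [Nat.count_eq_card_filter_range, ← Set.ncard_coe_finset]
    congr 1
    ext i
    simp only [Set.mem_ofPred_eq, Finset.coe_filter, Finset.mem_range, hmap]
    refine and_congr_right fun _ => ⟨?_, ?_⟩
    · rintro ⟨l', t, ht, h1⟩
      exact ⟨t, ht, by rw [h1]⟩
    · rintro ⟨t, ht, rfl⟩
      exact ⟨_, t, ht, rfl⟩
  have hget : ∀ τ k l, (β τ).get? k = some l ↔ ∃ j t, μ.get? j = some t ∧ t.2.1 = (τ, l) ∧
      Nat.count (fun i => ∃ t, μ.get? i = some t ∧ t.2.1.1 = τ) j = k := by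
    intro τ k l
    rw [hind τ k l]
    constructor
    · rintro ⟨j, hj, h2⟩
      obtain ⟨t, ht, h1⟩ := (hmap j _).mp hj
      exact ⟨j, t, ht, h1, (hcount τ j).symm.trans h2⟩
    · rintro ⟨j, t, ht, h1, h2⟩
      exact ⟨j, (hmap j _).mpr ⟨t, ht, h1⟩, (hcount τ j).trans h2⟩
  by_cases hterm : μ.Terminates
  · left
    obtain ⟨N, hN⟩ := hterm
    intro τ
    refine ⟨N, ?_⟩
    by_contra hne
    -- The `N`-th label of a thread sits at a position of the run that is at least `N`, beyond the
    -- end of the run.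
    obtain ⟨l, hl⟩ := Option.ne_none_iff_exists'.mp hne
    obtain ⟨j, t, ht, -, hj⟩ := (hget τ N l).mp hl
    have hjN : j < N := by
      by_contra hle
      have := Stream'.Seq.le_stable μ (not_lt.mp hle) hN
      rw [ht] at this
      cases this
    have := Nat.count_le (p := fun i => ∃ t, μ.get? i = some t ∧ t.2.1.1 = τ) (n := j)
    omega
  right
  have hsched := hfair.resolve_left hterm
  -- The global state before position `j`. The run does not terminate in this case, so keeping the
  -- state when no transition is present is only a default.
  let st : ℕ → P.lts.Q := fun j => Nat.rec P.lts.init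
    (fun j p => match μ.get? j with | some t => t.2.2 | none => p) j
  have st_succ : ∀ j t, μ.get? j = some t → st (j + 1) = t.2.2 := by
    intro j t ht
    change (match μ.get? j with | some t => t.2.2 | none => st j) = _
    rw [ht]
  have st_none : ∀ j, μ.get? j = none → st (j + 1) = st j := by
    intro j ht
    change (match μ.get? j with | some t => t.2.2 | none => st j) = _
    rw [ht]
  have st_src : ∀ j t, μ.get? j = some t → t.1 = st j := by
    intro j t ht
    cases j with
    | zero => exact hrun.start t ht
    | succ j =>
      obtain ⟨t', ht'⟩ := Stream'.Seq.ge_stable μ (Nat.le_succ j) ht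
      rw [st_succ j t' ht']
      exact (hrun.chain j t' t ht' ht).symm
  intro τ
  set p : ℕ → Prop := fun i => ∃ t, μ.get? i = some t ∧ t.2.1.1 = τ with hp
  have idle : ∀ j, ¬ p j → st (j + 1) τ = st j τ := by
    intro j hj
    rcases hm : μ.get? j with _ | t
    · rw [st_none j hm]
    · have h2 := (hrun.trans j t hm).2 τ (fun h => hj ⟨t, hm, h.symm⟩)
      rw [st_succ j t hm, h2, st_src j t hm]
  have same_le : ∀ i j, i ≤ j → Nat.count p i = Nat.count p j → st i τ = st j τ := by
    intro i j hij
    induction j, hij using Nat.le_induction with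
    | base => intro _; rfl
    | succ j hj ih =>
      intro hc
      have h1 := Nat.count_monotone p hj
      rw [Nat.count_succ] at hc
      split_ifs at hc with hpj
      · omega
      · rw [idle j hpj]
        exact ih (by omega)
  have same : ∀ i j, Nat.count p i = Nat.count p j → st i τ = st j τ := by
    intro i j hc
    rcases le_total i j with hij | hij
    · exact same_le i j hij hc
    · exact (same_le j i hij hc.symm).symm
  -- The local state after `k` steps of `τ` is read off at any position preceded by exactly `k`
  -- steps of `τ`; by `same` the choice does not matter. The initial state is a default for
  -- unreached `k`.
  let s : ℕ → (P τ).Q := fun k => if hk : ∃ j, Nat.count p j = k then st hk.choose τ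
    else (P τ).init
  have hs : ∀ j, s (Nat.count p j) = st j τ := by
    intro j
    have hk : ∃ i, Nat.count p i = Nat.count p j := ⟨j, rfl⟩
    change (if hk : ∃ i, Nat.count p i = Nat.count p j then st hk.choose τ else _) = _
    rw [dif_pos hk]
    exact same _ _ hk.choose_spec
  have hocc : ∀ k l, (β τ).get? k = some l → ∃ j t, μ.get? j = some t ∧ t.2.1 = (τ, l) ∧
      Nat.count p j = k ∧ Nat.count p (j + 1) = k + 1 := by
    intro k l hl
    obtain ⟨j, t, ht, h1, h2⟩ := (hget τ k l).mp hl
    refine ⟨j, t, ht, h1, h2, ?_⟩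
    rw [Nat.count_succ, if_pos ⟨t, ht, by rw [h1]⟩, h2]
  refine ⟨s, ?_, ?_, ?_⟩
  · have := hs 0
    rw [Nat.count_zero] at this
    exact this
  · intro k l hl
    obtain ⟨j, t, ht, h1, h2, h3⟩ := hocc k l hl
    have := (hrun.trans j t ht).1
    rw [h1, st_src j t ht, ← st_succ j t ht] at this
    rw [← h3, hs, ← h2, hs]
    exact this
  · intro k hk hnone l q hq
    obtain ⟨j₀, hj₀⟩ : ∃ j, Nat.count p j = k := by
      cases k with
      | zero => exact ⟨0, Nat.count_zero p⟩
      | succ k =>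
        obtain ⟨l', hl'⟩ := Option.ne_none_iff_exists'.mp (hk k (Nat.lt_succ_self k))
        obtain ⟨j, -, -, -, -, h3⟩ := hocc k l' hl'
        exact ⟨j + 1, h3⟩
    have hnot : ∀ j, Nat.count p j = k → ¬ p j := by
      rintro j hj ⟨t, ht, hτ⟩
      have : (β τ).get? k = some t.2.1.2 := (hget τ k _).mpr ⟨j, t, ht, by rw [← hτ], hj⟩
      rw [hnone] at this
      cases this
    have hconst : ∀ j, j₀ ≤ j → Nat.count p j = k := by
      intro j hj
      induction j, hj using Nat.le_induction with
      | base => exact hj₀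
      | succ j _ ih => rw [Nat.count_succ, if_neg (hnot j ih), ih, add_zero]
    -- From `j₀` on the local state of `τ` is `s k`. An outgoing step would keep `τ` enabled
    -- forever, and fairness would schedule it once more.
    obtain ⟨j, hj, t, ht, hτ⟩ := hsched τ j₀ (by
      intro j hj t ht
      refine ⟨l, Function.update t.1 τ q, ?_, ?_⟩
      · have h1 : t.1 τ = s k := by rw [st_src j t ht, ← hs j, hconst j hj]
        have h2 := Function.update_self τ q (t.1 : ∀ τ, (P τ).Q)
        have h3 : (P τ).step (t.1 τ) l q := h1.symm ▸ hq
        exact h2.symm ▸ h3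
      · intro π hπ
        exact Function.update_of_ne hπ _ _)
    exact hnot j (hconst j hj) ⟨t, ht, hτ⟩

/-! ### Traces of a client thread, uniformly in the treatment of modes and fences -/

/-- The program point of the next memory access. -/
def PC.skip : PC → PC
  | .lockFenceRel => .swap
  | .lockFenceAcq => .readNext
  | .unlockFenceRel => .readNext
  | .unlockFenceAcq succ => if succ = 0 then .cas else .handOver succ
  | q => q

/-- A rank that every step except an idle iteration of a loop decreases. -/
def PC.rank : PC → ℕ
  | .setLocked => 13
  | .clearNext => 12
  | .lockFenceRel => 11
  | .swap => 10
  | .link _ => 9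
  | .spin => 8
  | .lockFenceAcq => 7
  | .unlockFenceRel => 6
  | .readNext => 5
  | .unlockFenceAcq _ => 4
  | .cas => 3
  | .awaitNext => 2
  | .handOver _ => 1
  | .done => 0

/-- The steps of a fenced thread that access memory, in any mode. -/
inductive MemStep {Acc Fen : Type} (n : Val) : PC → Lab Acc Fen → PC → Prop
  | setLocked (o) : MemStep n .setLocked (.W o (.locked n) 1) .clearNext
  | clearNext (o) : MemStep n .clearNext (.W o (.next n) 0) .lockFenceRel
  | swap (o) (pred : Val) : MemStep n .swap (.U o .lock pred n)
      (if pred = 0 then .unlockFenceRel else .link pred)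
  | link (o) (pred : Val) : MemStep n (.link pred) (.W o (.next pred) n) .spin
  | spin (o) (v : Val) : MemStep n .spin (.R o (.locked n) v)
      (if v = 1 then .spin else .lockFenceAcq)
  | readNext (o) (succ : Val) :
      MemStep n .readNext (.R o (.next n) succ) (.unlockFenceAcq succ)
  | casSuccess (o) : MemStep n .cas (.U o .lock n 0) .done
  | casFail (o) (v : Val) (hv : v ≠ n) : MemStep n .cas (.R o .lock v) .awaitNext
  | awaitNext (o) (succ : Val) : MemStep n .awaitNext (.R o (.next n) succ)
      (if succ = 0 then .awaitNext else .handOver succ)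
  | handOver (o) (succ : Val) : MemStep n (.handOver succ) (.W o (.locked succ) 0) .done

theorem PC.rank_skip_le (q : PC) : q.skip.rank ≤ q.rank := by
  cases q <;> simp only [PC.skip] <;> try split_ifs
  all_goals simp [PC.rank]

theorem PC.skip_eq_spin {q : PC} (h : q.skip = .spin) : q = .spin := by
  cases q <;> simp only [PC.skip] at h <;> try split_ifs at h
  all_goals first | rfl | cases h

theorem PC.skip_eq_awaitNext {q : PC} (h : q.skip = .awaitNext) : q = .awaitNext := by
  cases q <;> simp only [PC.skip] at h <;> try split_ifs at h
  all_goals first | rfl | cases h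

/-- The termination measure: an idle iteration is recognizable by the value it reads, which later
pins down the possible sources of an endless loop. -/
theorem MemStep.rank_lt_or_loop {Acc Fen : Type} {n : Val} {q q' : PC} {l : Lab Acc Fen}
    (h : MemStep n q l q') : q'.rank < q.rank ∨
      (q = .spin ∧ q' = .spin ∧ ∃ o, l = .R o (.locked n) 1) ∨
      (q = .awaitNext ∧ q' = .awaitNext ∧ ∃ o, l = .R o (.next n) 0) := by
  cases h with
  | spin o v =>
    by_cases hv : v = 1
    · subst hv; exact Or.inr (Or.inl ⟨rfl, by simp, o, rfl⟩)
    · left; simp [hv, PC.rank]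
  | awaitNext o v =>
    by_cases hv : v = 0
    · subst hv; exact Or.inr (Or.inr ⟨rfl, by simp, o, rfl⟩)
    · left; simp [hv, PC.rank]
  | swap o p => left; split_ifs <;> simp [PC.rank]
  | _ => left; simp [PC.rank]

theorem MemStep.rank_le {Acc Fen : Type} {n : Val} {q q' : PC} {l : Lab Acc Fen}
    (h : MemStep n q l q') : q'.rank ≤ q.rank := by
  rcases h.rank_lt_or_loop with h | ⟨rfl, rfl, -⟩ | ⟨rfl, rfl, -⟩
  · exact h.le
  · exact le_rfl
  · exact le_rfl

/-- `L` is the sequence of labels, and `s` a sequence of program points, of a thread with node `n`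
that halts only at the end of its program. -/
structure ThreadTrace {Acc Fen : Type} (n : Val) (L : ℕ → Option (Lab Acc Fen)) (s : ℕ → PC) :
    Prop where
  start : s 0 = .setLocked
  step : ∀ k l, L k = some l → MemStep n (s k).skip l (s (k + 1)) ∨
    ((l.loc = none ∨ l.loc = some .fenceLoc) ∧ (s (k + 1)).skip = (s k).skip ∧
      (s (k + 1)).rank < (s k).rank)
  closed : ∀ k, L k = none → L (k + 1) = none
  halts : ∀ k, (∀ i < k, L i ≠ none) → L k = none → s k = .done

/-- The `k`-th step of a thread accesses memory at program point `q` with label `l`. -/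
structure MemAt {Acc Fen : Type} (n : Val) (L : ℕ → Option (Lab Acc Fen)) (s : ℕ → PC) (q : PC)
    (k : ℕ) (l : Lab Acc Fen) : Prop where
  get : L k = some l
  state : (s k).skip = q
  step : MemStep n q l (s (k + 1))

namespace ThreadTrace

variable {Acc Fen : Type} {n : Val} {L : ℕ → Option (Lab Acc Fen)} {s : ℕ → PC}

theorem rank_succ_le (T : ThreadTrace n L s) {k : ℕ} (h : L k ≠ none) :
    (s (k + 1)).rank ≤ (s k).rank := by
  obtain ⟨l, hl⟩ := Option.ne_none_iff_exists'.mp h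
  rcases T.step k l hl with h | h
  · exact h.rank_le.trans (PC.rank_skip_le _)
  · exact h.2.2.le

theorem ne_none_of_le (T : ThreadTrace n L s) {i k : ℕ} (hik : i ≤ k) (h : L k ≠ none) :
    L i ≠ none := by
  intro hi
  apply h
  induction k, hik using Nat.le_induction with
  | base => exact hi
  | succ k _ ih => exact T.closed k (by by_contra h'; exact h' (ih h'))

theorem rank_anti (T : ThreadTrace n L s) {j k : ℕ} (hjk : j ≤ k) (h : ∀ i < k, L i ≠ none) :
    (s k).rank ≤ (s j).rank := by
  induction k, hjk using Nat.le_induction with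
  | base => exact le_rfl
  | succ k _ ih =>
    exact (T.rank_succ_le (h k (Nat.lt_succ_self k))).trans
      (ih fun i hi => h i (Nat.lt_succ_of_lt hi))

theorem rank_anti_of_get (T : ThreadTrace n L s) {j k : ℕ} {l : Lab Acc Fen} (hjk : j ≤ k)
    (h : L k = some l) : (s k).rank ≤ (s j).rank :=
  T.rank_anti hjk fun i hi => T.ne_none_of_le hi.le (by simp [h])

/-- The rank never increases along a trace, so comparing the ranks of two program points decides the
order in which they are passed. All program order edges of the client are obtained in this way. -/
theorem lt_of_rank (T : ThreadTrace n L s) {q q' : PC} {j k : ℕ} {l l' : Lab Acc Fen}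
    (hj : MemAt n L s q j l) (hk : MemAt n L s q' k l') (h : q'.rank < q.rank) : j < k := by
  by_contra hle
  rcases (not_lt.mp hle).eq_or_lt with rfl | hlt
  · rw [← hj.state, ← hk.state] at h
    exact lt_irrefl _ h
  · have h1 := T.rank_anti_of_get (Nat.succ_le_of_lt hlt) hj.get
    have h2 := hk.step.rank_le
    have h3 := PC.rank_skip_le (s j)
    rw [hj.state] at h3
    simp only [Nat.succ_eq_add_one] at h1
    omega

theorem not_lt_of_state (T : ThreadTrace n L s) {q : PC} {j k : ℕ} {l l' : Lab Acc Fen}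
    (hj : MemAt n L s q j l) (hk : MemAt n L s q k l') (hs : q ≠ .spin) (ha : q ≠ .awaitNext) :
    ¬ j < k := by
  intro hlt
  have h1 := T.rank_anti_of_get (Nat.succ_le_of_lt hlt) hk.get
  have h3 := PC.rank_skip_le (s k)
  rw [hk.state] at h3
  rcases hj.step.rank_lt_or_loop with h2 | h2 | h2
  · simp only [Nat.succ_eq_add_one] at h1
    omega
  · exact hs h2.1
  · exact ha h2.1

/-- Outside the loops, every program point is passed at most once. -/
theorem eq_of_state (T : ThreadTrace n L s) {q : PC} {j k : ℕ} {l l' : Lab Acc Fen}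
    (hj : MemAt n L s q j l) (hk : MemAt n L s q k l') (hs : q ≠ .spin) (ha : q ≠ .awaitNext) :
    j = k ∧ l = l' := by
  have : j = k := le_antisymm (not_lt.mp (T.not_lt_of_state hk hj hs ha))
    (not_lt.mp (T.not_lt_of_state hj hk hs ha))
  subst this
  exact ⟨rfl, Option.some.inj (hj.get.symm.trans hk.get)⟩

theorem memAt_of_loc (T : ThreadTrace n L s) {k : ℕ} {l : Lab Acc Fen} (h : L k = some l)
    {x : Loc} (hl : l.loc = some x) (hx : x ≠ .fenceLoc) : ∃ q, MemAt n L s q k l := by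
  rcases T.step k l h with h' | ⟨h' | h', -⟩
  · exact ⟨_, h, rfl, h'⟩
  · rw [hl] at h'; cases h'
  · rw [hl] at h'; cases h'; exact absurd rfl hx

end ThreadTrace

/-! ### Invariants on the accesses a thread has made -/

section Past

variable {Acc Fen : Type} (n : Val) (L : ℕ → Option (Lab Acc Fen)) (s : ℕ → PC)

/-- The thread has initialized its node and passed the swap. -/
def Acquired (pred : Val) : Prop :=
  (∃ k o, MemAt n L s .setLocked k (.W o (.locked n) 1)) ∧
  (∃ k o, MemAt n L s .clearNext k (.W o (.next n) 0)) ∧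
  (∃ k o, MemAt n L s .swap k (.U o .lock pred n))

/-- The thread has passed the linking of its node, if the swap made it necessary. -/
def Linked (pred : Val) : Prop :=
  pred = 0 ∨ ∃ k o, MemAt n L s (.link pred) k (.W o (.next pred) n)

/-- The thread has a read of the field `next` with value `succ`, before the hand-over. -/
def ReadsNext (succ : Val) : Prop :=
  ∃ k o q, 1 < q.rank ∧ MemAt n L s q k (.R o (.next n) succ)

/-- What a thread has done when it arrives at a program point. -/
def Past : PC → Prop
  | .clearNext => ∃ k o, MemAt n L s .setLocked k (.W o (.locked n) 1)
  | .swap => (∃ k o, MemAt n L s .setLocked k (.W o (.locked n) 1)) ∧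
      (∃ k o, MemAt n L s .clearNext k (.W o (.next n) 0))
  | .link pred => pred ≠ 0 ∧ Acquired n L s pred
  | .spin => ∃ pred, pred ≠ 0 ∧ Acquired n L s pred ∧ Linked n L s pred
  | .readNext => ∃ pred, Acquired n L s pred ∧ Linked n L s pred
  | .cas => ∃ pred, Acquired n L s pred ∧ Linked n L s pred
  | .awaitNext => (∃ pred, Acquired n L s pred ∧ Linked n L s pred) ∧
      ∃ k o v, v ≠ n ∧ MemAt n L s .cas k (.R o .lock v)
  | .handOver succ => (∃ pred, Acquired n L s pred ∧ Linked n L s pred) ∧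
      succ ≠ 0 ∧ ReadsNext n L s succ
  | .done => (∃ pred, Acquired n L s pred ∧ Linked n L s pred) ∧
      ((∃ k o, MemAt n L s .cas k (.U o .lock n 0)) ∨
        ∃ succ, succ ≠ 0 ∧ ReadsNext n L s succ ∧
          ∃ k o, MemAt n L s (.handOver succ) k (.W o (.locked succ) 0))
  | _ => True

end Past

namespace ThreadTrace

variable {Acc Fen : Type} {n : Val} {L : ℕ → Option (Lab Acc Fen)} {s : ℕ → PC}

theorem past_succ {k : ℕ} {l : Lab Acc Fen} {q q' : PC} (h : L k = some l)
    (hq : (s k).skip = q) (hq' : s (k + 1) = q') (hs : MemStep n q l q') (hp : Past n L s q) :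
    Past n L s q'.skip := by
  have hm : MemAt n L s q k l := ⟨h, hq, hq' ▸ hs⟩
  clear hq hq' h
  cases hs with
  | setLocked o => exact ⟨k, o, hm⟩
  | clearNext o => exact ⟨hp, k, o, hm⟩
  | swap o p =>
    have ha : Acquired n L s p := ⟨hp.1, hp.2, k, o, hm⟩
    split_ifs with h0
    · exact ⟨p, ha, Or.inl h0⟩
    · exact ⟨h0, ha⟩
  | link o p => exact ⟨p, hp.1, hp.2, Or.inr ⟨k, o, hm⟩⟩
  | spin o v =>
    obtain ⟨p, h0, ha, hl⟩ := hp
    split_ifs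
    · exact ⟨p, h0, ha, hl⟩
    · exact ⟨p, ha, hl⟩
  | readNext o v =>
    have hr : ReadsNext n L s v := ⟨k, o, _, by simp [PC.rank], hm⟩
    simp only [PC.skip]
    split_ifs with h0
    · exact hp
    · exact ⟨hp, h0, hr⟩
  | casSuccess o => exact ⟨hp, Or.inl ⟨k, o, hm⟩⟩
  | casFail o v hv => exact ⟨hp, k, o, v, hv, hm⟩
  | awaitNext o v =>
    have hr : ReadsNext n L s v := ⟨k, o, _, by simp [PC.rank], hm⟩
    split_ifs with h0
    · exact hp
    · exact ⟨hp.1, h0, hr⟩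
  | handOver o v => exact ⟨hp.1, Or.inr ⟨v, hp.2.1, hp.2.2, k, o, hm⟩⟩

theorem past (T : ThreadTrace n L s) (k : ℕ) (h : ∀ i < k, L i ≠ none) :
    Past n L s (s k).skip := by
  induction k with
  | zero => rw [T.start]; trivial
  | succ k ih =>
    obtain ⟨l, hl⟩ := Option.ne_none_iff_exists'.mp (h k (Nat.lt_succ_self k))
    have hp := ih fun i hi => h i (Nat.lt_succ_of_lt hi)
    rcases T.step k l hl with hs | ⟨-, hs, -⟩
    · exact past_succ hl rfl rfl hs hp
    · rw [hs]; exact hp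

theorem past_of_memAt (T : ThreadTrace n L s) {q : PC} {k : ℕ} {l : Lab Acc Fen}
    (h : MemAt n L s q k l) : Past n L s q :=
  h.state ▸ T.past k fun i hi => T.ne_none_of_le (le_of_lt hi) (by simp [h.get])

/-- A thread completes its program or stays in one of the two loops forever. -/
theorem outcome (T : ThreadTrace n L s) :
    ((∃ k, L k = none) ∧ Past n L s .done) ∨
    (Past n L s .spin ∧ ∃ k₀, ∀ k ≥ k₀, ∃ o, MemAt n L s .spin k (.R o (.locked n) 1)) ∨
    (Past n L s .awaitNext ∧ ∃ k₀, ∀ k ≥ k₀, ∃ o, MemAt n L s .awaitNext k (.R o (.next n) 0)) := by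
  classical
  by_cases hfin : ∃ k, L k = none
  · left
    refine ⟨hfin, ?_⟩
    have hlt : ∀ i < Nat.find hfin, L i ≠ none := fun i hi => Nat.find_min hfin hi
    have hp := T.past _ hlt
    rw [T.halts _ hlt (Nat.find_spec hfin)] at hp
    exact hp
  right
  push Not at hfin
  -- Take an index of minimal rank. No later step can lower the rank, so every later step is an idle
  -- iteration of a loop.
  obtain ⟨k₀, hk₀⟩ : ∃ k₀, ∀ k, (s k₀).rank ≤ (s k).rank := by
    have hne : (Set.range fun k => (s k).rank).Nonempty := ⟨_, 0, rfl⟩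
    obtain ⟨k₀, h⟩ := Nat.sInf_mem hne
    exact ⟨k₀, fun k => by simp only at h; rw [h]; exact Nat.sInf_le ⟨k, rfl⟩⟩
  have hloop : ∀ k ≥ k₀, (s k = .spin ∧ s (k + 1) = .spin ∧
        ∃ o, MemAt n L s .spin k (.R o (.locked n) 1)) ∨
      (s k = .awaitNext ∧ s (k + 1) = .awaitNext ∧
        ∃ o, MemAt n L s .awaitNext k (.R o (.next n) 0)) := by
    intro k hk
    obtain ⟨l, hl⟩ := Option.ne_none_iff_exists'.mp (hfin k)
    have h1 := T.rank_anti hk fun i _ => hfin i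
    have h2 := hk₀ (k + 1)
    rcases T.step k l hl with hs | ⟨-, -, hs⟩
    · have h3 := PC.rank_skip_le (s k)
      rcases hs.rank_lt_or_loop with h4 | ⟨h4, h5, o, rfl⟩ | ⟨h4, h5, o, rfl⟩
      · omega
      · exact Or.inl ⟨PC.skip_eq_spin h4, h5, o, hl, h4, h4 ▸ hs⟩
      · exact Or.inr ⟨PC.skip_eq_awaitNext h4, h5, o, hl, h4, h4 ▸ hs⟩
    · omega
  have hp := T.past k₀ fun i _ => hfin i
  rcases hloop k₀ le_rfl with ⟨h0, -⟩ | ⟨h0, -⟩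
  · left
    rw [h0] at hp
    have hst : ∀ k ≥ k₀, s k = .spin := by
      intro k hk
      induction k, hk using Nat.le_induction with
      | base => exact h0
      | succ k hk ih =>
        rcases hloop k hk with h | h
        · exact h.2.1
        · rw [ih] at h; cases h.1
    refine ⟨hp, k₀, fun k hk => ?_⟩
    rcases hloop k hk with h | h
    · exact h.2.2
    · rw [hst k hk] at h; cases h.1
  · right
    rw [h0] at hp
    have hst : ∀ k ≥ k₀, s k = .awaitNext := by
      intro k hk
      induction k, hk using Nat.le_induction with
      | base => exact h0
      | succ k hk ih =>
        rcases hloop k hk with h | h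
        · rw [ih] at h; cases h.1
        · exact h.2.1
    refine ⟨hp, k₀, fun k hk => ?_⟩
    rcases hloop k hk with h | h
    · rw [hst k hk] at h; cases h.1
    · exact h.2.2

end ThreadTrace

/-! ### The three readings of the client produce such traces -/

/-- Fences do not change the next memory access. Invariants attached to `skip` are therefore
insensitive to whether a fence is an event, a read-modify-write or nothing. -/
theorem Step.memStep_or_fence {n : Val} {q q' : PC} {c : CLab} (h : Step true n q c q') :
    (q.skip = q ∧ MemStep n q c q' ∧ ∃ l, c.forget = some l) ∨
      ((∃ o, c = .F o) ∧ q'.skip = q.skip ∧ q'.rank < q.rank) := by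
  cases h
  case casFail v hv => exact Or.inl ⟨rfl, .casFail _ v hv, _, rfl⟩
  all_goals first
    | exact Or.inl ⟨rfl, by constructor, _, rfl⟩
    | (right; refine ⟨⟨_, rfl⟩, ?_, ?_⟩ <;> first | rfl | (simp [PC.rank]; done) |
        (split_ifs <;> simp [PC.rank, PC.skip, *]))

theorem MemStep.forget {n : Val} {q q' : PC} {c : CLab} {l : ELab} (h : MemStep n q c q')
    (hl : c.forget = some l) : MemStep n q l q' := by
  cases h <;> cases hl
  all_goals constructor
  assumption

theorem PC.exists_step {q : PC} (n : Val) (h : q ≠ .done) : ∃ c q', Step true n q c q' := by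
  cases q
  case cas => exact ⟨_, _, .casSuccess⟩
  case spin => exact ⟨_, _, .spin 0⟩
  case swap => exact ⟨_, _, .swap 0⟩
  case awaitNext => exact ⟨_, _, .awaitNext 0⟩
  case readNext => exact ⟨_, _, .readNext 0⟩
  case done => exact absurd rfl h
  all_goals exact ⟨_, _, by constructor⟩

theorem PC.exists_fences {q : PC} (n : Val) (h : q ≠ .done) :
    Relation.ReflTransGen (fun p p' => ∃ o, Step true n p (.F o) p') q q.skip ∧
      ∃ c q' l, Step true n q.skip c q' ∧ c.forget = some l := by
  constructor
  · cases q
    case lockFenceRel => exact .single ⟨_, .lockFenceRel⟩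
    case lockFenceAcq => exact .head ⟨_, .lockFenceAcq⟩ (.single ⟨_, .unlockFenceRel⟩)
    case unlockFenceRel => exact .single ⟨_, .unlockFenceRel⟩
    case unlockFenceAcq v => exact .single ⟨_, .unlockFenceAcq v⟩
    all_goals exact .refl
  · have h1 : q.skip ≠ .done := by
      cases q <;> simp only [PC.skip] <;> try split_ifs
      all_goals first | exact h | exact PC.noConfusion
    have h2 : q.skip.skip = q.skip := by
      cases q <;> simp only [PC.skip]
      try split_ifs
      all_goals rfl
    obtain ⟨c, q', hs⟩ := PC.exists_step n h1
    rcases hs.memStep_or_fence with ⟨-, -, l, hl⟩ | ⟨⟨o, rfl⟩, -⟩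
    · exact ⟨c, q', l, hs, hl⟩
    · generalize q.skip = p at hs h2
      cases hs <;> simp only [PC.skip] at h2
      all_goals try split_ifs at h2
      all_goals cases h2

/-- Common interface of the three readings: since every program point but the last has an outgoing
step, a thread that halts under thread-fairness has completed its program. -/
theorem ThreadTrace.of_steps {Acc Fen : Type} {n : Val} {σ : Stream'.Seq (Lab Acc Fen)}
    {s : ℕ → PC} {R : PC → Lab Acc Fen → PC → Prop} (h0 : s 0 = .setLocked)
    (hstep : ∀ k l, σ.get? k = some l → R (s k) l (s (k + 1)))
    (hhalt : ∀ k, (∀ i < k, σ.get? i ≠ none) → σ.get? k = none → ∀ l q, ¬ R (s k) l q)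
    (hR : ∀ q l q', R q l q' → MemStep n q.skip l q' ∨
      ((l.loc = none ∨ l.loc = some .fenceLoc) ∧ q'.skip = q.skip ∧ q'.rank < q.rank))
    (hR' : ∀ q, q ≠ .done → ∃ l q', R q l q') : ThreadTrace n σ.get? s where
  start := h0
  step k l hl := hR _ _ _ (hstep k l hl)
  closed k hk := Stream'.Seq.le_stable σ (Nat.le_succ k) hk
  halts k hk hk' := by
    by_contra hne
    obtain ⟨l, q, h⟩ := hR' _ hne
    exact hhalt k hk hk' l q h

/-- The node of a thread of the client. -/
def node (a b : Val) (τ : Tid) : Val := if τ = 0 then a else b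

theorem threadTrace_of_step {n : Val} {σ : Stream'.Seq CLab} {s : ℕ → PC}
    (h0 : s 0 = .setLocked)
    (hstep : ∀ k l, σ.get? k = some l → Step true n (s k) l (s (k + 1)))
    (hhalt : ∀ k, (∀ i < k, σ.get? i ≠ none) → σ.get? k = none →
      ∀ l q, ¬ Step true n (s k) l q) : ThreadTrace n σ.get? s := by
  refine .of_steps h0 hstep hhalt ?_ fun q hq => PC.exists_step n hq
  intro q l q' h
  rcases h.memStep_or_fence with ⟨h1, h2, -⟩ | ⟨⟨o, rfl⟩, h2⟩
  · exact Or.inl (h1.symm ▸ h2)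
  · exact Or.inr ⟨Or.inl rfl, h2⟩

theorem skip_eq_of_fences {n : Val} {q q' : PC}
    (h : Relation.ReflTransGen (fun p p' => ∃ o, Step true n p (.F o) p') q q') :
    q'.skip = q.skip := by
  induction h with
  | refl => rfl
  | tail _ h ih =>
    obtain ⟨o, h⟩ := h
    rcases h.memStep_or_fence with ⟨-, -, l, hl⟩ | ⟨-, h2, -⟩
    · cases hl
    · exact h2.trans ih

theorem plain_threadTraces (i : FenceReading) {a b : Val} {β : Behavior Unit Empty}
    (h : β ∈ ((mcsClient true a b).plain i).behTF) :
    β.Finite ∨ ∀ τ, ∃ s, ThreadTrace (node a b τ) (β τ).get? s := by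
  refine (Program.exists_local_states h).imp id fun h τ => ?_
  cases i with
  | rmw =>
    obtain ⟨s, h0, h1, h2⟩ := h τ
    refine ⟨s, .of_steps (R := fun q l q' => (∃ c, Step true (node a b τ) q c q' ∧
      c.forget = some l) ∨ ∃ o v, Step true (node a b τ) q (.F o) q' ∧ l = .U () .fenceLoc v v)
      h0 h1 h2 ?_ ?_⟩
    · rintro q l q' (⟨c, h, hl⟩ | ⟨o, v, h, rfl⟩)
      · rcases h.memStep_or_fence with ⟨h1, h2, -⟩ | ⟨⟨o, rfl⟩, -⟩
        · exact Or.inl (h1.symm ▸ h2.forget hl)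
        · cases hl
      · rcases h.memStep_or_fence with ⟨-, -, l, hl⟩ | ⟨-, h2⟩
        · cases hl
        · exact Or.inr ⟨Or.inr rfl, h2⟩
    · intro q hq
      obtain ⟨c, q', hs⟩ := PC.exists_step (node a b τ) hq
      rcases hs.memStep_or_fence with ⟨-, -, l, hl⟩ | ⟨⟨o, rfl⟩, -⟩
      · exact ⟨l, q', Or.inl ⟨c, hs, hl⟩⟩
      · exact ⟨_, q', Or.inr ⟨o, 0, hs, rfl⟩⟩
  | nop =>
    obtain ⟨s, h0, h1, h2⟩ := h τ
    refine ⟨s, .of_steps (R := fun q l q' => ∃ q₁ c,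
      Relation.ReflTransGen (fun p p' => ∃ o, Step true (node a b τ) p (.F o) p') q q₁ ∧
        Step true (node a b τ) q₁ c q' ∧ c.forget = some l) h0 h1 h2 ?_ ?_⟩
    · rintro q l q' ⟨q₁, c, hq, h, hl⟩
      rcases h.memStep_or_fence with ⟨h1, h2, -⟩ | ⟨⟨o, rfl⟩, -⟩
      · left
        rw [← skip_eq_of_fences hq, h1]
        exact h2.forget hl
      · cases hl
    · intro q hq
      obtain ⟨h1, c, q', l, h2, h3⟩ := PC.exists_fences (node a b τ) hq
      exact ⟨l, q', _, c, h1, h2, h3⟩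

/-! ### Finiteness from coherence, atomicity, synchronization and fairness -/

open Relation

theorem Tid.eq_of_ne {τ σ ρ : Tid} (h : σ ≠ τ) (h' : ρ ≠ τ) : σ = ρ := by
  revert τ σ ρ; decide

theorem Tid.exists_ne (τ : Tid) : ∃ τ' : Tid, τ' ≠ τ := by
  revert τ; decide

/-- What the argument needs of a memory model: coherence and atomicity with respect to a
happens-before relation, and the two kinds of synchronization that the client makes use of. -/
structure Sync {Acc Fen : Type} (G : ExecGraph Acc Fen) (n : Tid → Val)
    (hb : Event Acc Fen → Event Acc Fen → Prop) : Prop where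
  hb_of_po : ∀ e e', G.po e e' → hb e e'
  hb_trans : ∀ e₁ e₂ e₃, hb e₁ e₂ → hb e₂ e₃ → hb e₁ e₃
  not_mo_of_hb : ∀ e e', hb e e' → ¬ G.mo e' e
  not_fr_of_po : ∀ e e', G.po e e' → ¬ G.fr e' e
  eco_irrefl : Irrefl (TransGen fun e e' => G.rf e e' ∨ G.mo e e' ∨ G.fr e e')
  hb_of_lock : ∀ w r, G.rf w r → w.IsU → w.loc = some .lock → hb w r
  -- The first alternative is needed for RC11: a read of `next` in the waiting loop comes after the
  -- acquire fence, so the link need not synchronize, but then a CAS has failed and acquired from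
  -- the lock. A plain read of the lock can only be a failed CAS.
  hb_of_link : ∀ τ τ' i j k m oi q oj v lr om q',
    Event.act i τ (.W oi (.locked (n τ)) 1) ∈ G.E →
    G.rf (.act j τ (.W oj (.next q) v)) (.act k τ' lr) →
    Event.act m τ' (.W om (.locked q') 0) ∈ G.E → v ≠ 0 → i < j → k < m →
    (∃ c o v', Event.act c τ' (.R o .lock v') ∈ G.E) ∨
      hb (.act i τ (.W oi (.locked (n τ)) 1)) (.act m τ' (.W om (.locked q') 0))

/-- An execution graph of the client. -/
structure ClientGraph {Acc Fen : Type} (G : ExecGraph Acc Fen) (β : Behavior Acc Fen)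
    (n : Tid → Val) (s : Tid → ℕ → PC) (hb : Event Acc Fen → Event Acc Fen → Prop) : Prop where
  events : β.events = G.E
  trace : ∀ τ, ThreadTrace (n τ) (β τ).get? (s τ)
  node_ne : ∀ τ, n τ ≠ 0
  node_inj : ∀ τ τ', n τ = n τ' → τ = τ'
  sync : Sync G n hb
  fair : G.Fair

namespace ClientGraph

variable {Acc Fen : Type} {G : ExecGraph Acc Fen} {β : Behavior Acc Fen} {n : Tid → Val}
  {s : Tid → ℕ → PC} {hb : Event Acc Fen → Event Acc Fen → Prop}

/-- The `k`-th step of thread `τ` accesses memory at program point `q` with label `l`. -/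
abbrev At (_ : ClientGraph G β n s hb) (τ : Tid) (q : PC) (k : ℕ) (l : Lab Acc Fen) : Prop :=
  MemAt (n τ) (β τ).get? (s τ) q k l

/-! ### The order of the lock operations -/

theorem mem_iff (C : ClientGraph G β n s hb) {k : ℕ} {τ : Tid} {l : Lab Acc Fen} :
    Event.act k τ l ∈ G.E ↔ (β τ).get? k = some l := by
  rw [← C.events]
  constructor
  · rintro (⟨x, h⟩ | ⟨k', τ', l', h, h'⟩)
    · cases h
    · cases h'; exact h
  · intro h
    exact Or.inr ⟨k, τ, l, h, rfl⟩

theorem mem (C : ClientGraph G β n s hb) {k : ℕ} {τ : Tid} {q : PC} {l : Lab Acc Fen}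
    (h : C.At τ q k l) : Event.act k τ l ∈ G.E :=
  C.mem_iff.mpr h.get

theorem po (C : ClientGraph G β n s hb) {j k : ℕ} {τ : Tid} {q q' : PC} {l l' : Lab Acc Fen}
    (h : C.At τ q j l) (h' : C.At τ q' k l') (hr : q'.rank < q.rank) :
    G.po (.act j τ l) (.act k τ l') :=
  ⟨C.mem h, C.mem h', rfl, (C.trace τ).lt_of_rank h h' hr⟩

theorem po_init (C : ClientGraph G β n s hb) {k : ℕ} {τ : Tid} {q : PC} {l : Lab Acc Fen}
    (x : Loc) (h : C.At τ q k l) : G.po (.init x) (.act k τ l) :=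
  ⟨G.init_mem x, C.mem h, trivial⟩

theorem not_rf_rf (C : ClientGraph G β n s hb) {w r : Event Acc Fen} (h : G.rf w r) :
    ¬ G.rf r w := fun h' =>
  C.sync.eco_irrefl w (.tail (.single (Or.inl h)) (Or.inl h'))

theorem not_rf_mo (C : ClientGraph G β n s hb) {w r : Event Acc Fen} (h : G.rf w r) :
    ¬ G.mo r w := fun h' =>
  C.sync.eco_irrefl w (.tail (.single (Or.inl h)) (Or.inr (Or.inl h')))

/-- No write is between the source of a read-modify-write and the read-modify-write. -/
theorem not_between (C : ClientGraph G β n s hb) {w u x : Event Acc Fen} (h : G.rf w u)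
    (h1 : G.mo w x) : ¬ G.mo x u := by
  intro h2
  have hne : u ≠ x := by
    rintro rfl
    exact G.mo_irrefl _ h2
  exact C.sync.eco_irrefl u
    (.tail (.single (Or.inr (Or.inr ⟨⟨w, h, h1⟩, hne⟩))) (Or.inr (Or.inl h2)))

/-- A write is read by at most one read-modify-write. -/
theorem rmw_unique (C : ClientGraph G β n s hb) {w u u' : Event Acc Fen} (h : G.rf w u)
    (h' : G.rf w u') (hu : u.IsW) (hu' : u'.IsW) : u = u' := by
  by_contra hne
  have d := G.rf_dom _ _ h
  have d' := G.rf_dom _ _ h'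
  have mo_of : ∀ u, G.rf w u → u.IsW → G.mo w u := by
    intro u h hu
    have d := G.rf_dom _ _ h
    refine (G.mo_total _ d.1 _ d.2.1 d.2.2.1 hu d.2.2.2.2.1 ?_).resolve_right (C.not_rf_mo h)
    rintro rfl
    exact C.not_rf_rf h h
  rcases G.mo_total _ d.2.1 _ d'.2.1 hu hu' (d.2.2.2.2.1.symm.trans d'.2.2.2.2.1) hne with m | m
  · exact C.not_between h' (mo_of u h hu) m
  · exact C.not_between h (mo_of u' h' hu') m

theorem at_of_loc (C : ClientGraph G β n s hb) {k : ℕ} {τ : Tid} {l : Lab Acc Fen} {x : Loc}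
    (h : Event.act k τ l ∈ G.E) (hl : l.loc = some x) (hx : x ≠ .fenceLoc) :
    ∃ q, C.At τ q k l :=
  (C.trace τ).memAt_of_loc (C.mem_iff.mp h) hl hx

/-- Only a swap writes a nonzero value to the lock, and that value identifies the thread. -/
theorem lock_write (C : ClientGraph G β n s hb) {w : Event Acc Fen} (h : w ∈ G.E) (hw : w.IsW)
    (hl : w.loc = some .lock) : w = .init .lock ∨ ∃ k τ o,
      (∃ p, w = .act k τ (.U o .lock p (n τ)) ∧ C.At τ .swap k (.U o .lock p (n τ))) ∨
      (w = .act k τ (.U o .lock (n τ) 0) ∧ C.At τ .cas k (.U o .lock (n τ) 0)) := by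
  cases w with
  | init x => cases hl; exact Or.inl rfl
  | act k τ l =>
    right
    obtain ⟨q, hq⟩ := C.at_of_loc h hl (by simp)
    have hst := hq.step
    generalize s τ (k + 1) = q' at hst
    cases hst with
    | swap o p => exact ⟨k, τ, o, Or.inl ⟨p, rfl, hq⟩⟩
    | casSuccess o => exact ⟨k, τ, o, Or.inr ⟨rfl, hq⟩⟩
    | casFail => exact hw.elim
    | _ => cases hl

/-- Since nodes are nonzero, a read of `null` comes from the initialization or the clearing, and a
read of a node from a link. -/
theorem next_write (C : ClientGraph G β n s hb) {w : Event Acc Fen} {x : Val} (h : w ∈ G.E)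
    (hw : w.IsW) (hl : w.loc = some (.next x)) : w = .init (.next x) ∨ ∃ k τ o,
      (x = n τ ∧ w = .act k τ (.W o (.next x) 0) ∧ C.At τ .clearNext k (.W o (.next x) 0)) ∨
      (w = .act k τ (.W o (.next x) (n τ)) ∧ C.At τ (.link x) k (.W o (.next x) (n τ))) := by
  cases w with
  | init x => cases hl; exact Or.inl rfl
  | act k τ l =>
    right
    obtain ⟨q, hq⟩ := C.at_of_loc h hl (by simp)
    have hst := hq.step
    generalize s τ (k + 1) = q' at hst
    cases hst with
    | clearNext o => cases hl; exact ⟨k, τ, o, Or.inl ⟨rfl, rfl, hq⟩⟩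
    | link o p => cases hl; exact ⟨k, τ, o, Or.inr ⟨rfl, hq⟩⟩
    | readNext => exact hw.elim
    | awaitNext => exact hw.elim
    | _ => cases hl

theorem locked_write_one (C : ClientGraph G β n s hb) {w : Event Acc Fen} {x : Val} (h : w ∈ G.E)
    (hw : w.IsW) (hl : w.loc = some (.locked x)) (hv : w.valw = some 1) : ∃ k τ o,
      x = n τ ∧ w = .act k τ (.W o (.locked x) 1) ∧ C.At τ .setLocked k (.W o (.locked x) 1) := by
  cases w with
  | init x => cases hv
  | act k τ l =>
    obtain ⟨q, hq⟩ := C.at_of_loc h hl (by simp)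
    have hst := hq.step
    generalize s τ (k + 1) = q' at hst
    cases hst with
    | setLocked o => cases hl; exact ⟨k, τ, o, rfl, rfl, hq⟩
    | handOver => cases hv
    | spin => exact hw.elim
    | _ => cases hl

theorem swap_unique (C : ClientGraph G β n s hb) {τ : Tid} {j k : ℕ} {l l' : Lab Acc Fen}
    (h : C.At τ .swap j l) (h' : C.At τ .swap k l') : j = k ∧ l = l' :=
  (C.trace τ).eq_of_state h h' (by simp) (by simp)

theorem cas_unique (C : ClientGraph G β n s hb) {τ : Tid} {j k : ℕ} {l l' : Lab Acc Fen}
    (h : C.At τ .cas j l) (h' : C.At τ .cas k l') : j = k ∧ l = l' :=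
  (C.trace τ).eq_of_state h h' (by simp) (by simp)

/-- A nonzero value read from the lock is the node of a thread, and read from its swap. -/
theorem rf_swap (C : ClientGraph G β n s hb) {r : Event Acc Fen} {v : Val} (h : r ∈ G.E)
    (hr : r.IsR) (hl : r.loc = some .lock) (hv : r.valr = some v) (hv0 : v ≠ 0) : ∃ k τ o p,
      v = n τ ∧ C.At τ .swap k (.U o .lock p (n τ)) ∧ G.rf (.act k τ (.U o .lock p (n τ))) r := by
  obtain ⟨w, hw⟩ := G.rf_total r h hr
  have d := G.rf_dom _ _ hw
  have hval := d.2.2.2.2.2.trans hv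
  rcases C.lock_write d.1 d.2.2.1 (d.2.2.2.2.1.trans hl) with
    rfl | ⟨k, τ, o, ⟨p, rfl, hs⟩ | ⟨rfl, hs⟩⟩
  · cases hval; exact absurd rfl hv0
  · cases hval; exact ⟨k, τ, o, p, rfl, hs, hw⟩
  · cases hval; exact absurd rfl hv0

/-- A successful CAS reads from the swap of its thread. -/
theorem rf_cas (C : ClientGraph G β n s hb) {τ : Tid} {j k : ℕ} {o o' : Acc} {p : Val}
    (hs : C.At τ .swap j (.U o .lock p (n τ))) (hc : C.At τ .cas k (.U o' .lock (n τ) 0)) :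
    G.rf (.act j τ (.U o .lock p (n τ))) (.act k τ (.U o' .lock (n τ) 0)) := by
  obtain ⟨j', τ', o₁, p₁, hn, hs', hrf⟩ :=
    C.rf_swap (C.mem hc) trivial rfl rfl (C.node_ne τ)
  obtain rfl := C.node_inj _ _ hn
  obtain ⟨rfl, h⟩ := C.swap_unique hs hs'
  cases h
  exact hrf

/-- A failing CAS reads from a later write to the lock by the other thread. -/
theorem casFail_source (C : ClientGraph G β n s hb) {τ : Tid} {j k : ℕ} {o o' : Acc} {p v : Val}
    (hs : C.At τ .swap j (.U o .lock p (n τ))) (hc : C.At τ .cas k (.R o' .lock v)) :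
    ∃ k' τ' q' l', τ' ≠ τ ∧ C.At τ' q' k' l' ∧ (q' = .swap ∨ q' = .cas) ∧
      (Event.act k' τ' l').IsU ∧ l'.loc = some .lock ∧
      G.rf (.act k' τ' l') (.act k τ (.R o' .lock v)) ∧
      G.mo (.act j τ (.U o .lock p (n τ))) (.act k' τ' l') := by
  have hv : v ≠ n τ := by
    have hst := hc.step
    generalize s τ (k + 1) = q' at hst
    cases hst; assumption
  obtain ⟨w, hw⟩ := G.rf_total _ (C.mem hc) trivial
  have d := G.rf_dom _ _ hw
  have hval : w.valw = some v := d.2.2.2.2.2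
  have hpo := C.po hs hc (by simp [PC.rank])
  have hne : w ≠ .act j τ (.U o .lock p (n τ)) := by
    rintro rfl
    cases hval
    exact hv rfl
  -- A source `mo`-before the thread's own swap would make the CAS `fr`-before a write that precedes
  -- it in program order.
  have hmo : G.mo (.act j τ (.U o .lock p (n τ))) w := by
    refine (G.mo_total w d.1 _ (C.mem hs) d.2.2.1 trivial d.2.2.2.2.1 hne).resolve_left fun hm => ?_
    exact C.sync.not_fr_of_po _ _ hpo ⟨⟨w, hw, hm⟩, by simp⟩
  rcases C.lock_write d.1 d.2.2.1 d.2.2.2.2.1 with rfl | ⟨k', τ', o₁, h⟩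
  · exact absurd hmo (C.sync.not_mo_of_hb _ _ (C.sync.hb_of_po _ _ (C.po_init _ hs)))
  · have hτ : τ' ≠ τ := by
      rintro rfl
      rcases h with ⟨p', rfl, h⟩ | ⟨rfl, h⟩
      · obtain ⟨rfl, h'⟩ := C.swap_unique hs h
        cases h'
        exact hne rfl
      · cases (C.cas_unique hc h).2
    rcases h with ⟨p', rfl, h⟩ | ⟨rfl, h⟩
    · exact ⟨k', τ', _, _, hτ, h, Or.inl rfl, trivial, rfl, hw, hmo⟩
    · exact ⟨k', τ', _, _, hτ, h, Or.inr rfl, trivial, rfl, hw, hmo⟩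

/-- If the CAS of a thread fails, the swap of the other thread reads from the swap of this one. -/
theorem rf_of_casFail (C : ClientGraph G β n s hb) {τ τ' : Tid} {j j' k : ℕ} {o o' o₁ : Acc}
    {p p' v : Val} (hτ : τ' ≠ τ) (hs : C.At τ .swap j (.U o .lock p (n τ)))
    (hs' : C.At τ' .swap j' (.U o₁ .lock p' (n τ'))) (hc : C.At τ .cas k (.R o' .lock v)) :
    G.rf (.act j τ (.U o .lock p (n τ))) (.act j' τ' (.U o₁ .lock p' (n τ'))) := by
  obtain ⟨k', τ'', q', l', hτ', h, hq, hU, hl, -, hmo⟩ := C.casFail_source hs hc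
  obtain rfl := Tid.eq_of_ne hτ' hτ
  have hne : (.act j τ (.U o .lock p (n τ)) : Event Acc Fen) ≠ .act j' τ'' (.U o₁ .lock p' (n τ'')) := by
    intro h; cases h; exact hτ rfl
  have hmo' : G.mo (.act j τ (.U o .lock p (n τ))) (.act j' τ'' (.U o₁ .lock p' (n τ''))) := by
    rcases hq with rfl | rfl
    · obtain ⟨rfl, rfl⟩ := C.swap_unique h hs'
      exact hmo
    · refine (G.mo_total _ (C.mem hs) _ (C.mem hs') trivial trivial rfl hne).resolve_right
        fun hm => ?_
      have hst := h.step
      generalize s τ'' (k' + 1) = q₁ at hst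
      cases hst with
      -- The successful CAS of the other thread reads from that thread's swap, and by atomicity no
      -- write fits between the two.
      | casSuccess o₂ => exact C.not_between (C.rf_cas hs' h) hm hmo
      | casFail => exact hU
  obtain ⟨w, hw⟩ := G.rf_total _ (C.mem hs') trivial
  have d := G.rf_dom _ _ hw
  -- Candidates for the source of the other swap: the initialization is excluded since the first
  -- swap would lie in between, the CAS of `τ` because it failed, and the other thread's own swap
  -- and CAS because of `rf` cycles.
  rcases C.lock_write d.1 d.2.2.1 d.2.2.2.2.1 with rfl | ⟨k₂, σ, o₂, ⟨p₂, rfl, h₂⟩ | ⟨rfl, h₂⟩⟩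
  · refine absurd hmo' (C.not_between hw ?_)
    refine (G.mo_total _ (G.init_mem _) _ (C.mem hs) trivial trivial rfl
      (by simp)).resolve_right ?_
    exact C.sync.not_mo_of_hb _ _ (C.sync.hb_of_po _ _ (C.po_init _ hs))
  · by_cases hσ : σ = τ
    · subst hσ
      obtain ⟨rfl, h'⟩ := C.swap_unique hs h₂
      cases h'
      exact hw
    · obtain rfl := Tid.eq_of_ne hσ hτ
      obtain ⟨rfl, h'⟩ := C.swap_unique hs' h₂
      cases h'
      exact absurd hw (C.not_rf_rf hw)
  · by_cases hσ : σ = τ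
    · subst hσ
      cases (C.cas_unique hc h₂).2
    · obtain rfl := Tid.eq_of_ne hσ hτ
      exact absurd hw (C.not_rf_rf (C.rf_cas hs' h₂))

/-! ### Fairness and termination of the loops -/

theorem not_infinite_fr (C : ClientGraph G β n s hb) {τ : Tid} {k₀ : ℕ}
    {w : Event Acc Fen} (hw : w ∈ G.E) (h : ∀ k ≥ k₀, ∃ l, G.fr (.act k τ l) w) : False := by
  choose l hl using h
  have hf := C.fair.2 w hw
  have hinj : Function.Injective fun i =>
      Event.act (k₀ + i) τ (l (k₀ + i) (Nat.le_add_right _ _)) := by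
    intro i j hij
    simp only [Event.act.injEq] at hij
    omega
  refine Set.infinite_range_of_injective hinj (hf.subset ?_)
  rintro _ ⟨i, rfl⟩
  exact hl _ _

/-- The swap and the possible link lie before both loops, so even a thread that loops forever has
performed them. -/
theorem acquired (C : ClientGraph G β n s hb) (τ : Tid) :
    ∃ p, Acquired (n τ) (β τ).get? (s τ) p ∧ Linked (n τ) (β τ).get? (s τ) p := by
  rcases (C.trace τ).outcome with ⟨-, h, -⟩ | ⟨⟨p, -, h⟩, -⟩ | ⟨⟨h, -⟩, -⟩
  · exact h
  · exact ⟨p, h⟩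
  · exact h

/-- The second loop terminates. -/
theorem not_await_forever (C : ClientGraph G β n s hb) {τ : Tid} {k₀ : ℕ}
    (hp : Past (n τ) (β τ).get? (s τ) .awaitNext)
    (h : ∀ k ≥ k₀, ∃ o, C.At τ .awaitNext k (.R o (.next (n τ)) 0)) : False := by
  obtain ⟨⟨p, ⟨-, ⟨i, oi, hclear⟩, ⟨j, oj, hswap⟩⟩, -⟩, k, o, v, -, hcas⟩ := hp
  obtain ⟨τ', hτ⟩ := Tid.exists_ne τ
  obtain ⟨p', ⟨-, -, ⟨j', oj', hswap'⟩⟩, hlink⟩ := C.acquired τ'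
  have hrf := C.rf_of_casFail hτ hswap hswap' hcas
  have hp' : p' = n τ := by
    have := (G.rf_dom _ _ hrf).2.2.2.2.2
    cases this
    rfl
  subst hp'
  obtain ⟨m, om, hm⟩ := hlink.resolve_left (C.node_ne τ)
  -- Clearing, own swap, other swap, link: the swaps synchronize through the lock.
  have hb1 : hb (.act i τ (.W oi (.next (n τ)) 0)) (.act m τ' (.W om (.next (n τ)) (n τ'))) :=
    C.sync.hb_trans _ _ _ (C.sync.hb_of_po _ _ (C.po hclear hswap (by simp [PC.rank])))
      (C.sync.hb_trans _ _ _ (C.sync.hb_of_lock _ _ hrf trivial rfl)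
        (C.sync.hb_of_po _ _ (C.po hswap' hm (by simp [PC.rank]))))
  have mo_of : ∀ w ∈ G.E, w.IsW → w.loc = some (.next (n τ)) → w.valw = some 0 →
      hb w (.act m τ' (.W om (.next (n τ)) (n τ'))) →
      G.mo w (.act m τ' (.W om (.next (n τ)) (n τ'))) := by
    intro w hw hW hl hv hh
    refine (G.mo_total w hw _ (C.mem hm) hW trivial hl ?_).resolve_right
      (C.sync.not_mo_of_hb _ _ hh)
    rintro rfl
    exact C.node_ne τ' (Option.some.inj hv)
  refine C.not_infinite_fr (τ := τ) (k₀ := k₀) (C.mem hm) fun k hk => ?_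
  obtain ⟨o, hr⟩ := h k hk
  obtain ⟨w, hw⟩ := G.rf_total _ (C.mem hr) trivial
  have d := G.rf_dom _ _ hw
  refine ⟨_, ⟨w, hw, mo_of w d.1 d.2.2.1 d.2.2.2.2.1 d.2.2.2.2.2 ?_⟩, by simp⟩
  have hval : w.valw = some 0 := d.2.2.2.2.2
  rcases C.next_write d.1 d.2.2.1 d.2.2.2.2.1 with rfl | ⟨k', σ, o', ⟨hσ, rfl, h'⟩ | ⟨rfl, h'⟩⟩
  · exact C.sync.hb_of_po _ _ (C.po_init _ hm)
  · obtain rfl := C.node_inj _ _ hσ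
    obtain ⟨rfl, hl⟩ := (C.trace τ).eq_of_state h' hclear (by simp) (by simp)
    rw [hl]
    exact hb1
  · exact absurd (Option.some.inj hval) (C.node_ne σ)

/-- The first loop terminates. -/
theorem not_spin_forever (C : ClientGraph G β n s hb) {τ : Tid} {k₀ : ℕ}
    (hp : Past (n τ) (β τ).get? (s τ) .spin)
    (h : ∀ k ≥ k₀, ∃ o, C.At τ .spin k (.R o (.locked (n τ)) 1)) : False := by
  obtain ⟨p, hp0, ⟨⟨i, oi, hset⟩, -, ⟨j, oj, hswap⟩⟩, hlink⟩ := hp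
  obtain ⟨mj, omj, hlk⟩ := hlink.resolve_left hp0
  obtain ⟨j', τ', oj', p', rfl, hswap', hrf⟩ := C.rf_swap (C.mem hswap) trivial rfl rfl hp0
  have hτ : τ' ≠ τ := by
    rintro rfl
    obtain ⟨rfl, h'⟩ := C.swap_unique hswap hswap'
    rw [← h'] at hrf
    exact C.not_rf_rf hrf hrf
  -- Otherwise the other swap would read from `τ`'s swap, which reads from it, or from itself.
  have hp' : p' = 0 := by
    by_contra hp'
    obtain ⟨j₂, τ₂, o₂, p₂, rfl, h₂, hrf₂⟩ := C.rf_swap (C.mem hswap') trivial rfl rfl hp'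
    by_cases hτ₂ : τ₂ = τ
    · subst hτ₂
      obtain ⟨rfl, h'⟩ := C.swap_unique hswap h₂
      rw [← h'] at hrf₂
      exact C.not_rf_rf hrf hrf₂
    · obtain rfl := Tid.eq_of_ne hτ₂ hτ
      obtain ⟨rfl, h'⟩ := C.swap_unique hswap' h₂
      rw [← h'] at hrf₂
      exact C.not_rf_rf hrf₂ hrf₂
  have hpred : ∀ p₂, Acquired (n τ') (β τ').get? (s τ') p₂ → p₂ = 0 := by
    rintro p₂ ⟨-, -, j₂, o₂, h₂⟩
    have := (C.swap_unique hswap' h₂).2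
    cases this
    exact hp'
  obtain ⟨succ, hsucc, ⟨kr, okr, q, hq, hread⟩, m, om, hm⟩ : ∃ succ, succ ≠ 0 ∧
      ReadsNext (n τ') (β τ').get? (s τ') succ ∧
      ∃ k o, C.At τ' (.handOver succ) k (.W o (.locked succ) 0) := by
    rcases (C.trace τ').outcome with ⟨-, h'⟩ | ⟨⟨p₂, h0, ha, -⟩, -⟩ | ⟨hp₂, k₂, h₂⟩
    · refine h'.2.resolve_left ?_
      rintro ⟨kc, oc, hc⟩
      have := C.rmw_unique hrf (C.rf_cas hswap' hc) trivial trivial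
      simp only [Event.act.injEq] at this
      exact hτ this.2.1.symm
    · exact absurd (hpred p₂ ha) h0
    · exact (C.not_await_forever hp₂ h₂).elim
  obtain ⟨hsn, km, okm, hrl⟩ : succ = n τ ∧ ∃ km okm, G.rf
      (.act km τ (.W okm (.next (n τ')) (n τ))) (.act kr τ' (.R okr (.next (n τ')) succ)) ∧
      C.At τ (.link (n τ')) km (.W okm (.next (n τ')) (n τ)) := by
    obtain ⟨w, hw⟩ := G.rf_total _ (C.mem hread) trivial
    have d := G.rf_dom _ _ hw
    have hval : w.valw = some succ := d.2.2.2.2.2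
    rcases C.next_write d.1 d.2.2.1 d.2.2.2.2.1 with rfl | ⟨k', σ, o', ⟨-, rfl, -⟩ | ⟨rfl, h'⟩⟩
    · exact absurd (Option.some.inj hval).symm hsucc
    · exact absurd (Option.some.inj hval).symm hsucc
    · by_cases hσ : σ = τ
      · subst hσ
        exact ⟨(Option.some.inj hval).symm, k', o', hw, h'⟩
      · obtain rfl := Tid.eq_of_ne hσ hτ
        -- A link by the other thread itself would require its swap to have read a nonzero value.
        have hpast := (C.trace σ).past_of_memAt h'
        exact absurd (hpred _ hpast.2) hpast.1
  subst hsn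
  have hb1 : hb (.act i τ (.W oi (.locked (n τ)) 1)) (.act m τ' (.W om (.locked (n τ)) 0)) := by
    rcases C.sync.hb_of_link τ τ' i km kr m oi (n τ') okm (n τ) _ om (n τ) (C.mem hset) hrl.1
      (C.mem hm) (C.node_ne τ) ((C.trace τ).lt_of_rank hset hrl.2 (by simp [PC.rank]))
      ((C.trace τ').lt_of_rank hread hm (by simpa [PC.rank] using hq)) with ⟨c, o, v, hc⟩ | h'
    · obtain ⟨q', hc'⟩ := C.at_of_loc hc rfl (by simp)
      have hq' : q' = .cas := by
        have hst := hc'.step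
        generalize s τ' (c + 1) = q₁ at hst
        cases hst; rfl
      subst hq'
      -- The failed CAS reads from a lock operation of `τ`, which comes after `locked := 1` in
      -- program order, and it precedes the hand-over.
      obtain ⟨k₂, τ₂, q₂, l₂, hτ₂, h₂, hq₂, hU, hl, hrf₂, -⟩ := C.casFail_source hswap' hc'
      obtain rfl := Tid.eq_of_ne hτ₂ hτ.symm
      refine C.sync.hb_trans _ _ _ (C.sync.hb_of_po _ _ (C.po hset h₂ ?_))
        (C.sync.hb_trans _ _ _ (C.sync.hb_of_lock _ _ hrf₂ hU hl)
          (C.sync.hb_of_po _ _ (C.po hc' hm (by simp [PC.rank]))))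
      rcases hq₂ with rfl | rfl <;> simp [PC.rank]
    · exact h'
  have hmo : G.mo (.act i τ (.W oi (.locked (n τ)) 1)) (.act m τ' (.W om (.locked (n τ)) 0)) :=
    (G.mo_total _ (C.mem hset) _ (C.mem hm) trivial trivial rfl (by simp)).resolve_right
      (C.sync.not_mo_of_hb _ _ hb1)
  refine C.not_infinite_fr (τ := τ) (k₀ := k₀) (C.mem hm) fun k hk => ?_
  obtain ⟨o, hr⟩ := h k hk
  obtain ⟨w, hw⟩ := G.rf_total _ (C.mem hr) trivial
  have d := G.rf_dom _ _ hw
  obtain ⟨k', σ, o', hσ, rfl, h'⟩ :=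
    C.locked_write_one d.1 d.2.2.1 d.2.2.2.2.1 d.2.2.2.2.2
  obtain rfl := C.node_inj _ _ hσ
  obtain ⟨rfl, hl⟩ := (C.trace τ).eq_of_state h' hset (by simp) (by simp)
  rw [hl] at hw
  exact ⟨_, ⟨_, hw, hmo⟩, by simp⟩

theorem finite (C : ClientGraph G β n s hb) : β.Finite := by
  intro τ
  rcases (C.trace τ).outcome with ⟨⟨k, hk⟩, -⟩ | ⟨hp, k₀, h⟩ | ⟨hp, k₀, h⟩
  · exact ⟨k, hk⟩
  · exact (C.not_spin_forever hp h).elim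
  · exact (C.not_await_forever hp h).elim

end ClientGraph

/-! ### The memory models provide coherence and synchronization -/
namespace ExecGraph

section Generic

variable {Acc Fen : Type} {G : ExecGraph Acc Fen}

theorem po_trans {e₁ e₂ e₃ : Event Acc Fen} (h : G.po e₁ e₂) (h' : G.po e₂ e₃) : G.po e₁ e₃ := by
  refine ⟨h.1, h'.2.1, ?_⟩
  have h1 := h.2.2
  have h2 := h'.2.2
  cases e₁ <;> cases e₂ <;> cases e₃ <;> simp only [Event.SB] at h1 h2 ⊢
  exact ⟨h1.1.trans h2.1, h1.2.trans h2.2⟩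

theorem exists_loc_of_isW {e : Event Acc Fen} (h : e.IsW) : ∃ x, e.loc = some x := by
  rcases e with x | ⟨k, τ, _ | _ | _ | _⟩
  · exact ⟨x, rfl⟩
  · exact h.elim
  · exact ⟨_, rfl⟩
  · exact ⟨_, rfl⟩
  · exact h.elim

theorem mo_loc {w w' : Event Acc Fen} (h : G.mo w w') :
    ∃ x, w.loc = some x ∧ w'.loc = some x := by
  have d := G.mo_dom _ _ h
  obtain ⟨x, hx⟩ := exists_loc_of_isW d.2.2.1
  exact ⟨x, hx, d.2.2.2.2.symm.trans hx⟩

theorem fr_loc {r w : Event Acc Fen} (h : G.fr r w) : ∃ x, r.loc = some x ∧ w.loc = some x := by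
  obtain ⟨⟨w', hrf, hmo⟩, -⟩ := h
  obtain ⟨x, hx, hx'⟩ := mo_loc hmo
  exact ⟨x, (G.rf_dom _ _ hrf).2.2.2.2.1.symm.trans hx, hx'⟩

end Generic

section Plain

variable {G : ExecGraph Unit Empty} {n : Tid → Val}

theorem hbRA_of_po {e e' : Event Unit Empty} (h : G.po e e') : G.hbRA e e' :=
  .single (Or.inl h)

/-- Here `rf` is part of happens-before, so the link and its read synchronize without any fence.
Only coherence and atomicity remain to be shown for each model. -/
theorem sync_hbRA (hmo : ∀ e e', G.hbRA e e' → ¬ G.mo e' e) (hfr : ∀ e e', G.po e e' → ¬ G.fr e' e)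
    (heco : Irrefl (TransGen fun e e' => G.rf e e' ∨ G.mo e e' ∨ G.fr e e')) :
    Sync G n G.hbRA where
  hb_of_po _ _ h := hbRA_of_po h
  hb_trans _ _ _ h h' := h.trans h'
  not_mo_of_hb := hmo
  not_fr_of_po := hfr
  eco_irrefl := heco
  hb_of_lock _ _ h _ _ := .single (Or.inr h)
  hb_of_link τ τ' i j k m oi q oj v lr om q' hi hrf hm _ hij hkm := by
    have d := G.rf_dom _ _ hrf
    exact Or.inr (.tail (.tail (.single (Or.inl ⟨hi, d.1, rfl, hij⟩)) (Or.inr hrf))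
      (Or.inl ⟨d.2.1, hm, rfl, hkm⟩))

theorem RA.sync (h : G.RA) : Sync G n G.hbRA := by
  refine sync_hbRA (fun e e' hb hm => ?_) (fun e e' hp hf => ?_) fun e he => ?_
  · obtain ⟨x, h1, h2⟩ := mo_loc hm
    exact h e (.tail (.single (Or.inl ⟨hb, x, h2, h1⟩)) (Or.inr (Or.inr (Or.inl hm))))
  · obtain ⟨x, h1, h2⟩ := fr_loc hf
    exact h e (.tail (.single (Or.inl ⟨hbRA_of_po hp, x, h2, h1⟩)) (Or.inr (Or.inr (Or.inr hf))))
  · exact h e (TransGen.mono (fun _ _ h => Or.inr h) _ _ he)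

theorem SC.sync (h : G.SC) : Sync G n G.hbRA := by
  refine sync_hbRA (fun e e' hb hm => ?_) (fun e e' hp hf => ?_) fun e he => ?_
  · exact h e (.tail (hb.lift id fun _ _ h => h.imp id Or.inl) (Or.inr (Or.inr (Or.inl hm))))
  · exact h e (.tail (.single (Or.inl hp)) (Or.inr (Or.inr (Or.inr hf))))
  · exact h e (TransGen.mono (fun _ _ h => Or.inr h) _ _ he)

/-- A happens-before path is a program order edge, or a path of preserved program order and external
reads-from to a read, followed by at most one program order edge. -/
theorem hbRA_cases {e e' : Event Unit Empty} (h : G.hbRA e e') : G.po e e' ∨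
    ∃ r, TransGen (fun e e' => G.ppo e e' ∨ G.rfe e e') e r ∧ r.IsR ∧ (r = e' ∨ G.po r e') := by
  -- An internal `rf` edge is absorbed into `po`. An external one starts at a write, and a `po` edge
  -- into a write is always preserved.
  have rfe_case : ∀ {e w r}, G.rf w r → (e = w ∨ G.po e w) → G.po e r ∨
      TransGen (fun e e' => G.ppo e e' ∨ G.rfe e e') e r := by
    intro e w r hrf hew
    by_cases hpo : G.po w r
    · left
      rcases hew with rfl | hew
      · exact hpo
      · exact po_trans hew hpo
    · right
      have hrfe : TransGen (fun e e' => G.ppo e e' ∨ G.rfe e e') w r := .single (Or.inr ⟨hrf, hpo⟩)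
      rcases hew with rfl | hew
      · exact hrfe
      · refine .head (Or.inl ⟨hew, fun hc => ?_⟩) hrfe
        have hw := (G.rf_dom _ _ hrf).2.2.1
        have h1 := hc.2
        rcases w with x | ⟨k, τ, _ | _ | _ | _⟩
        · exact h1.1
        · exact hw
        · exact h1.1
        · exact h1.2 trivial
        · exact hw
  induction h with
  | single h =>
    rcases h with h | h
    · exact Or.inl h
    · rcases rfe_case h (Or.inl rfl) with h' | h'
      · exact Or.inl h'
      · exact Or.inr ⟨_, h', (G.rf_dom _ _ h).2.2.2.1, Or.inl rfl⟩
  | tail _ h ih =>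
    rcases h with h | h
    · rcases ih with ih | ⟨r, h1, h2, rfl | h3⟩
      · exact Or.inl (po_trans ih h)
      · exact Or.inr ⟨r, h1, h2, Or.inr h⟩
      · exact Or.inr ⟨r, h1, h2, Or.inr (po_trans h3 h)⟩
    · have hr := (G.rf_dom _ _ h).2.2.2.1
      rcases ih with ih | ⟨r, h1, h2, h3⟩
      · exact (rfe_case h (Or.inr ih)).imp id fun h' => ⟨_, h', hr, Or.inl rfl⟩
      · rcases rfe_case h h3 with h' | h'
        · exact Or.inr ⟨r, h1, h2, Or.inr h'⟩
        · exact Or.inr ⟨_, h1.trans h', hr, Or.inl rfl⟩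

theorem ppo_of_isW {e e' : Event Unit Empty} (h : G.po e e') (hw : e'.IsW) : G.ppo e e' := by
  refine ⟨h, fun hc => ?_⟩
  have h1 := hc.2
  rcases e' with x | ⟨k, τ, _ | _ | _ | _⟩
  · exact h1.1
  · exact hw
  · exact h1.1
  · exact h1.2 trivial
  · exact hw

/-- The only `po` edge that may fail to be preserved is a final one into a plain read. A path that
is closed by `mo` ends in a write, so there all edges are preserved. -/
theorem TSO.sync (h : G.TSO) : Sync G n G.hbRA := by
  refine sync_hbRA (fun e e' hb hm => ?_) (fun e e' hp hf => ?_) fun e he => ?_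
  · have hw : e'.IsW := (G.mo_dom _ _ hm).2.2.1
    have hp : TransGen (fun e e' => G.ppo e e' ∨ G.rfe e e') e e' := by
      rcases hbRA_cases hb with hp | ⟨r, h1, -, rfl | h3⟩
      · exact .single (Or.inl (ppo_of_isW hp hw))
      · exact h1
      · exact .tail h1 (Or.inl (ppo_of_isW h3 hw))
    exact h.1 e (.tail (hp.lift id fun _ _ h => h.imp id Or.inl) (Or.inr (Or.inr (Or.inl hm))))
  · obtain ⟨x, h1, h2⟩ := fr_loc hf
    exact h.2 e (.tail (.single (Or.inl ⟨hp, x, h2, h1⟩)) (Or.inr (Or.inr (Or.inr hf))))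
  · exact h.2 e (TransGen.mono (fun _ _ h => Or.inr h) _ _ he)

end Plain

end ExecGraph

/-! ### Modes and fences of a fenced thread -/

/-- The modes of the accesses of the client. -/
def HasClientMode : CLab → Prop
  | .R o x _ => o = .rlx ∨ (o = .acq ∧ x = .lock)
  | .W o _ _ => o = .rlx
  | .U o _ _ _ => o = .acqrel
  | .F _ => True

theorem Step.hasClientMode {n : Val} {q q' : PC} {c : CLab} (h : Step true n q c q') :
    HasClientMode c := by
  cases h <;> simp [HasClientMode]

theorem Step.lock_mode {n : Val} {q q' : PC} {o : Mode} {v : Val}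
    (h : Step true n q (.R o .lock v) q') : o = .acq := by
  cases h; rfl

section Fences

variable {n : Val} {L : ℕ → Option CLab} {s : ℕ → PC}

/-- After the write to the node and up to the linking, a release fence has been passed. -/
theorem release_invariant (h0 : s 0 = .setLocked)
    (hstep : ∀ k l, L k = some l → Step true n (s k) l (s (k + 1))) (k : ℕ)
    (hk : ∀ i < k, L i ≠ none) : match s k with
      | .swap | .link _ => ∃ f < k, L f = some (.F .rel) ∧
          ∀ i < k, ∀ o, L i = some (.W o (.locked n) 1) → i < f
      | _ => True := by
  induction k with
  | zero => rw [h0]; trivial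
  | succ k ih =>
    obtain ⟨l, hl⟩ := Option.ne_none_iff_exists'.mp (hk k (Nat.lt_succ_self k))
    have ih := ih fun i hi => hk i (Nat.lt_succ_of_lt hi)
    have hs := hstep k l hl
    generalize s k = q at hs ih
    generalize s (k + 1) = q' at hs
    cases hs with
    | lockFenceRel =>
      refine ⟨k, Nat.lt_succ_self k, hl, fun i hi o ho => ?_⟩
      rcases (Nat.lt_succ_iff.mp hi).eq_or_lt with rfl | h
      · rw [hl] at ho; cases ho
      · exact h
    | swap p =>
      split_ifs
      · trivial
      · obtain ⟨f, hf, h1, h2⟩ := ih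
        refine ⟨f, Nat.lt_succ_of_lt hf, h1, fun i hi o ho => ?_⟩
        rcases (Nat.lt_succ_iff.mp hi).eq_or_lt with rfl | h
        · rw [hl] at ho; cases ho
        · exact h2 i h o ho
    | spin v => split_ifs <;> trivial
    | unlockFenceAcq v => split_ifs <;> trivial
    | awaitNext v => split_ifs <;> trivial
    | _ => trivial

/-- Before the hand-over, either a CAS has failed, or an acquire fence follows all reads of the
fields `next`. -/
theorem acquire_invariant (h0 : s 0 = .setLocked)
    (hstep : ∀ k l, L k = some l → Step true n (s k) l (s (k + 1))) (k : ℕ)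
    (hk : ∀ i < k, L i ≠ none) : match s k with
      | .awaitNext => ∃ c o v, L c = some (.R o .lock v)
      | .handOver _ => (∃ c o v, L c = some (.R o .lock v)) ∨ ∃ f < k, L f = some (.F .acq) ∧
          ∀ i < k, ∀ o x v, L i = some (.R o (.next x) v) → i < f
      | _ => True := by
  induction k with
  | zero => rw [h0]; trivial
  | succ k ih =>
    obtain ⟨l, hl⟩ := Option.ne_none_iff_exists'.mp (hk k (Nat.lt_succ_self k))
    have ih := ih fun i hi => hk i (Nat.lt_succ_of_lt hi)
    have hs := hstep k l hl
    generalize s k = q at hs ih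
    generalize s (k + 1) = q' at hs
    cases hs with
    | unlockFenceAcq v =>
      split_ifs
      · trivial
      · refine Or.inr ⟨k, Nat.lt_succ_self k, hl, fun i hi o x v ho => ?_⟩
        rcases (Nat.lt_succ_iff.mp hi).eq_or_lt with rfl | h
        · rw [hl] at ho; cases ho
        · exact h
    | casFail v hv => exact ⟨k, _, v, hl⟩
    | awaitNext v =>
      split_ifs
      · exact ih
      · exact Or.inl ih
    | swap v => split_ifs <;> trivial
    | spin v => split_ifs <;> trivial
    | _ => trivial

end Fences

namespace ExecGraph

variable {G : ExecGraph Mode Mode} {n : Tid → Val}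

theorem RC11.sync {β : Behavior Mode Mode} {s : Tid → ℕ → PC} (h : G.RC11) (hE : β.events = G.E)
    (h0 : ∀ τ, s τ 0 = .setLocked)
    (hstep : ∀ τ k l, (β τ).get? k = some l → Step true (n τ) (s τ k) l (s τ (k + 1))) :
    Sync G n G.hb := by
  have mem_iff : ∀ {k τ l}, Event.act k τ l ∈ G.E ↔ (β τ).get? k = some l := by
    intro k τ l
    rw [← hE]
    constructor
    · rintro (⟨x, h⟩ | ⟨k', τ', l', h, h'⟩)
      · cases h
      · cases h'; exact h
    · intro h
      exact Or.inr ⟨k, τ, l, h, rfl⟩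
  have before : ∀ {k τ l}, (β τ).get? k = some l → ∀ i < k, (β τ).get? i ≠ none := by
    intro k τ l hl i hi hn
    rw [Stream'.Seq.le_stable (β τ) hi.le hn] at hl
    cases hl
  exact
  { hb_of_po := fun e e' hp => .single (Or.inl hp)
    hb_trans := fun _ _ _ h h' => h.trans h'
    not_mo_of_hb := fun e e' hb hm => h.coherence e ⟨e', hb, .single (.single (Or.inr (Or.inl hm)))⟩
    not_fr_of_po := fun e e' hp hf =>
      h.coherence e ⟨e', .single (Or.inl hp), .single (.single (Or.inr (Or.inr hf)))⟩
    eco_irrefl := h.atomicity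
    hb_of_lock := by
      intro w r hrf hU hl
      have d := G.rf_dom _ _ hrf
      have hw : w.mode = .acqrel := by
        rcases w with x | ⟨k, τ, _ | _ | ⟨o, x, v, v'⟩ | _⟩
        · exact hU.elim
        · exact hU.elim
        · exact hU.elim
        · exact (hstep τ k _ (mem_iff.mp d.1)).hasClientMode
        · exact hU.elim
      have hr : r.mode = .acq ∨ r.mode = .acqrel := by
        have hlr := d.2.2.2.2.1.symm.trans hl
        have hR := d.2.2.2.1
        rcases r with x | ⟨k, τ, ⟨o, x, v⟩ | _ | ⟨o, x, v, v'⟩ | _⟩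
        · exact hR.elim
        · cases hlr
          exact Or.inl (hstep τ k _ (mem_iff.mp d.2.1)).lock_mode
        · exact hR.elim
        · exact Or.inr (hstep τ k _ (mem_iff.mp d.2.1)).hasClientMode
        · exact hR.elim
      -- Synchronization without fences: the release sequence consists of `w` alone and all optional
      -- parts are empty.
      refine .single (Or.inr ⟨w, ⟨rfl, ?_⟩, w, .refl, w, ⟨w, ⟨rfl, d.2.2.1⟩, w, .refl, w,
        ⟨rfl, d.2.2.1, ?_⟩, .refl⟩, r, hrf, r, ⟨rfl, d.2.2.2.1, ?_⟩, r, .refl, rfl, ?_⟩)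
      · simp [Mode.AtLeastRel, hw]
      · simp [Mode.AtLeastRlx, hw]
      · rcases hr with hr | hr <;> simp [Mode.AtLeastRlx, hr]
      · rcases hr with hr | hr <;> simp [Mode.AtLeastAcq, hr]
    hb_of_link := by
      intro τ τ' i j k m oi q oj v lr om q' hi hrf hm hv hij hkm
      have d := G.rf_dom _ _ hrf
      have hj := mem_iff.mp d.1
      have hr := mem_iff.mp d.2.1
      have hm' := mem_iff.mp hm
      obtain ⟨f, hfj, hf, hlast⟩ : ∃ f < j, (β τ).get? f = some (.F .rel) ∧
          ∀ i < j, ∀ o, (β τ).get? i = some (.W o (.locked (n τ)) 1) → i < f := by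
        have hinv := release_invariant (h0 τ) (hstep τ) j (before hj)
        have hs := hstep τ j _ hj
        generalize s τ j = p at hs hinv
        generalize s τ (j + 1) = p' at hs
        -- A write to a `next` field is a clearing, ruled out by the nonzero value, or a link, where
        -- the release fence has been passed.
        cases hs
        · exact absurd rfl hv
        · exact hinv
      have hif := hlast i hij oi (mem_iff.mp hi)
      have hacq : (∃ c o v, (β τ').get? c = some (.R o .lock v)) ∨
          ∃ f < m, (β τ').get? f = some (.F .acq) ∧
            ∀ i < m, ∀ o x v, (β τ').get? i = some (.R o (.next x) v) → i < f := by
        have hinv := acquire_invariant (h0 τ') (hstep τ') m (before hm')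
        have hs := hstep τ' m _ hm'
        generalize s τ' m = p at hs hinv
        generalize s τ' (m + 1) = p' at hs
        cases hs
        exact hinv
      refine hacq.imp (fun ⟨c, o, v, hc⟩ => ⟨c, o, v, mem_iff.mpr hc⟩) ?_
      rintro ⟨g, hgm, hg, hlast'⟩
      have hoj : oj = .rlx := (hstep τ j _ hj).hasClientMode
      have hlr : ∃ o v, lr = .R o (.next q) v ∧ o = .rlx := by
        have hmode := (hstep τ' k _ hr).hasClientMode
        have hloc := d.2.2.2.2.1
        have hR := d.2.2.2.1
        have hs := hstep τ' k _ hr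
        rcases lr with ⟨o, x, v⟩ | _ | ⟨o, x, v, v'⟩ | _
        · cases hloc
          refine ⟨o, v, rfl, hmode.resolve_right ?_⟩
          rintro ⟨-, h⟩
          cases h
        · exact hR.elim
        · cases hloc
          generalize s τ' k = p at hs
          generalize s τ' (k + 1) = p' at hs
          cases hs
        · exact hR.elim
      obtain ⟨or, vr, rfl, rfl⟩ := hlr
      subst hoj
      have hkg := hlast' k hkm _ _ _ hr
      have hfm := mem_iff.mpr hf
      have hgm' := mem_iff.mpr hg
      -- Fence-to-fence synchronization: release fence, relaxed link, relaxed read of `next`,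
      -- acquire fence.
      have hsw : G.sw (.act f τ (.F .rel)) (.act g τ' (.F .acq)) :=
        ⟨_, ⟨rfl, Or.inl rfl⟩, _, .single ⟨_, ⟨rfl, trivial⟩, hfm, d.1, rfl, hfj⟩, _,
          ⟨_, ⟨rfl, trivial⟩, _, .refl, _, ⟨rfl, trivial, Mode.noConfusion⟩, .refl⟩, _, hrf, _,
          ⟨rfl, trivial, Mode.noConfusion⟩, _,
          .single ⟨_, ⟨d.2.1, hgm', rfl, hkg⟩, rfl, trivial⟩, rfl, Or.inl rfl⟩
      exact .tail (.tail (.single (Or.inl ⟨hi, hfm, rfl, hif⟩)) (Or.inr hsw))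
        (Or.inl ⟨hgm', hm, rfl, hgm⟩) }

end ExecGraph

/-! ### Finiteness of the fenced client -/

section Client

variable {a b : Val}

theorem node_ne (ha : a ≠ 0) (hb : b ≠ 0) (τ : Tid) : node a b τ ≠ 0 := by
  unfold node; split_ifs <;> assumption

theorem node_inj (hab : a ≠ b) (τ τ' : Tid) (h : node a b τ = node a b τ') : τ = τ' := by
  unfold node at h
  split_ifs at h with h1 h2 h2
  · exact h1.trans h2.symm
  · exact absurd h hab
  · exact absurd h.symm hab
  · exact Tid.eq_of_ne h1 h2

theorem finite_of_plain (ha : a ≠ 0) (hb : b ≠ 0) (hab : a ≠ b) {i : FenceReading}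
    {β : Behavior Unit Empty} (h : β ∈ ((mcsClient true a b).plain i).behTF)
    {M : ExecGraph Unit Empty → Prop}
    (hM : ∀ G, M G → Sync G (node a b) G.hbRA)
    (hβ : β ∈ behDecl (fun G => M G ∧ G.Fair)) : β.Finite := by
  obtain ⟨G, ⟨hG, hf⟩, hE⟩ := hβ
  rcases plain_threadTraces i h with h | h
  · exact h
  · choose s hs using h
    exact ClientGraph.finite (G := G)
      ⟨hE, hs, node_ne ha hb, node_inj hab, hM G hG, hf⟩

theorem finite_of_RC11 (ha : a ≠ 0) (hb : b ≠ 0) (hab : a ≠ b) {β : Behavior Mode Mode}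
    (h : β ∈ (mcsClient true a b).behTF)
    (hβ : β ∈ behDecl (fun G => G.RC11 ∧ G.Fair)) : β.Finite := by
  obtain ⟨G, ⟨hG, hf⟩, hE⟩ := hβ
  rcases Program.exists_local_states h with h | h
  · exact h
  · choose s h0 hstep hhalt using h
    have hs : ∀ τ, ThreadTrace (node a b τ) (β τ).get? (s τ) := fun τ =>
      threadTrace_of_step (h0 τ) (hstep τ) (hhalt τ)
    exact ClientGraph.finite (G := G)
      ⟨hE, hs, node_ne ha hb, node_inj hab, hG.sync hE h0 hstep, hf⟩

end Client

/-! ### An infinite behavior of the client without the release fence -/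
namespace Unfenced

/-- The steps of thread 0, which takes and releases the lock and hands it over. -/
def label₀ (a b : Val) : ℕ → CLab
  | 0 => .W .rlx (.locked a) 1
  | 1 => .W .rlx (.next a) 0
  | 2 => .U .acqrel .lock 0 a
  | 3 => .F .rel
  | 4 => .R .rlx (.next a) b
  | 5 => .F .acq
  | _ => .W .rlx (.locked b) 0

/-- The steps of thread 1, which queues up and waits forever. -/
def label₁ (a b : Val) : ℕ → CLab
  | 0 => .W .rlx (.locked b) 1
  | 1 => .W .rlx (.next b) 0
  | 2 => .U .acqrel .lock a b
  | 3 => .W .rlx (.next a) b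
  | _ => .R .rlx (.locked b) 1

def pc₀ (b : Val) : ℕ → PC
  | 0 => .setLocked
  | 1 => .clearNext
  | 2 => .swap
  | 3 => .unlockFenceRel
  | 4 => .readNext
  | 5 => .unlockFenceAcq b
  | 6 => .handOver b
  | _ => .done

def pc₁ (a : Val) : ℕ → PC
  | 0 => .setLocked
  | 1 => .clearNext
  | 2 => .swap
  | 3 => .link a
  | _ => .spin

theorem step₀ {a b : Val} (hb : b ≠ 0) {k : ℕ} (hk : k < 7) :
    Step false a (pc₀ b k) (label₀ a b k) (pc₀ b (k + 1)) := by
  have h := Step.unlockFenceAcq (fenced := false) (n := a) b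
  rw [if_neg hb] at h
  interval_cases k
  · exact .setLocked
  · exact .clearNext
  · exact .swap 0
  · exact .unlockFenceRel
  · exact .readNext b
  · exact h
  · exact .handOver b

theorem step₁ {a b : Val} (ha : a ≠ 0) (k : ℕ) :
    Step false b (pc₁ a k) (label₁ a b k) (pc₁ a (k + 1)) := by
  have h := Step.swap (fenced := false) (n := b) a
  rw [if_neg ha] at h
  match k with
  | 0 => exact .setLocked
  | 1 => exact .clearNext
  | 2 => exact h
  | 3 => exact .link a
  | k + 4 => exact .spin 1

theorem pc₀_of_le {b : Val} {k : ℕ} (hk : 7 ≤ k) : pc₀ b k = .done := by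
  obtain ⟨k, rfl⟩ := Nat.exists_eq_add_of_le' hk
  rfl

/-- The behavior. -/
def behavior (a b : Val) : Behavior Mode Mode := fun τ =>
  ⟨fun k => if τ = 0 then (if k < 7 then some (label₀ a b k) else none) else some (label₁ a b k), by
    intro k
    change (if τ = 0 then (if k < 7 then some (label₀ a b k) else none)
      else some (label₁ a b k)) = none → (if τ = 0 then (if k + 1 < 7 then
        some (label₀ a b (k + 1)) else none) else some (label₁ a b (k + 1))) = none
    split_ifs <;> first | (intro h; cases h; done) | (intro; rfl) | omega⟩

theorem behavior_get? (a b : Val) (τ : Tid) (k : ℕ) : (behavior a b τ).get? k =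
    if τ = 0 then (if k < 7 then some (label₀ a b k) else none) else some (label₁ a b k) := rfl

/-- Reads are unconstrained at program level, so thread 0 may run to completion first although it
reads a link written by thread 1. Thread 0 takes seven steps; the truncated subtraction keeps thread
1 in its initial state meanwhile. -/
def state (a b : Val) (j : ℕ) : Tid → PC := fun τ => if τ = 0 then pc₀ b j else pc₁ a (j - 7)

def label (a b : Val) (j : ℕ) : Tid × CLab :=
  if j < 7 then (0, label₀ a b j) else (1, label₁ a b (j - 7))

/-- The run that schedules thread 0 until it is done, and then thread 1 forever. -/
def run (a b : Val) : Stream'.Seq ((mcsClient false a b).lts.Q × (Tid × CLab) ×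
    (mcsClient false a b).lts.Q) :=
  ⟨fun j => some (state a b j, label a b j, state a b (j + 1)), fun {k} h => by cases h⟩

theorem run_get? (a b : Val) (j : ℕ) :
    (run a b).get? j = some (state a b j, label a b j, state a b (j + 1)) := rfl

theorem run_isRun {a b : Val} (ha : a ≠ 0) (hb : b ≠ 0) :
    (mcsClient false a b).lts.IsRun (run a b) where
  trans k t ht := by
    rw [run_get?] at ht
    cases ht
    by_cases hk : k < 7
    · have hl : label a b k = (0, label₀ a b k) := if_pos hk
      simp only [hl]
      refine ⟨step₀ hb hk, fun π hπ => ?_⟩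
      change (if π = 0 then _ else pc₁ a (k + 1 - 7)) = if π = 0 then _ else pc₁ a (k - 7)
      rw [if_neg hπ, if_neg hπ]
      congr 1
      omega
    · have hl : label a b k = (1, label₁ a b (k - 7)) := if_neg hk
      simp only [hl]
      constructor
      · have h := step₁ (b := b) ha (k - 7)
        rw [← Nat.sub_add_comm (not_lt.mp hk)] at h
        exact h
      · intro π hπ
        obtain rfl : π = 0 := Tid.eq_of_ne hπ (zero_ne_one (α := Tid))
        change pc₀ b (k + 1) = pc₀ b k
        rw [pc₀_of_le (not_lt.mp hk), pc₀_of_le ((not_lt.mp hk).trans (Nat.le_succ k))]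
  start t ht := by
    rw [run_get?] at ht
    cases ht
    funext τ
    change (if τ = 0 then _ else _) = PC.setLocked
    split_ifs <;> rfl
  chain k t t' ht ht' := by
    rw [run_get?] at ht ht'
    cases ht
    cases ht'
    rfl

theorem run_threadFair (a b : Val) : (mcsClient false a b).ThreadFair (run a b) := by
  right
  intro τ k h
  by_cases hτ : τ = 0
  · subst hτ
    -- Thread 0 is done from position 7 on, so it is not continuously enabled from any position.
    obtain ⟨l, p', hs, -⟩ := h (max k 7) (le_max_left _ _) _ (run_get? a b _)
    change Step false a (pc₀ b (max k 7)) l (p' 0) at hs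
    rw [pc₀_of_le (le_max_right _ _)] at hs
    generalize p' 0 = q at hs
    cases hs
  · refine ⟨max k 7, le_max_left _ _, _, run_get? a b _, ?_⟩
    have hl : label a b (max k 7) = (1, _) := if_neg (not_lt.mpr (le_max_right _ _))
    simp only [hl]
    exact Tid.eq_of_ne (by decide) hτ

theorem run_induces (a b : Val) :
    Induces ((run a b).map fun t => t.2.1) (behavior a b) := by
  have hget : ∀ j, ((run a b).map fun t => t.2.1).get? j = some (label a b j) := by
    intro j
    rw [Stream'.Seq.map_get?, run_get?]
    rfl
  have hzero : ∀ j l, label a b j = (0, l) ↔ j < 7 ∧ label₀ a b j = l := by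
    intro j l
    unfold label
    split_ifs with h <;> simp [h]
  have hone : ∀ j l, label a b j = (1, l) ↔ 7 ≤ j ∧ label₁ a b (j - 7) = l := by
    intro j l
    unfold label
    split_ifs with h <;> simp [h, not_lt.mp]
  intro τ k l
  rw [behavior_get?]
  simp only [hget, Option.some.injEq]
  by_cases hτ : τ = 0
  · subst hτ
    simp only [if_true, hzero]
    have hcard : ∀ j, j < 7 → {i | i < j ∧ ∃ l', i < 7 ∧ label₀ a b i = l'}.ncard = j := by
      intro j hj
      have : {i | i < j ∧ ∃ l', i < 7 ∧ label₀ a b i = l'} = Set.Iio j := by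
        ext i
        constructor
        · exact fun h => h.1
        · exact fun h => ⟨h, _, lt_trans h hj, rfl⟩
      rw [this, ← Finset.coe_Iio, Set.ncard_coe_finset, Nat.card_Iio]
    constructor
    · intro h
      split_ifs at h with hk
      cases h
      exact ⟨k, ⟨hk, rfl⟩, hcard k hk⟩
    · rintro ⟨j, ⟨hj, rfl⟩, hk⟩
      rw [hcard j hj] at hk
      subst hk
      rw [if_pos hj]
  · obtain rfl : τ = 1 := Tid.eq_of_ne hτ (by decide)
    simp only [if_neg hτ, hone, Option.some.injEq]
    have hcard : ∀ j, {i | i < j ∧ ∃ l', 7 ≤ i ∧ label₁ a b (i - 7) = l'}.ncard = j - 7 := by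
      intro j
      have : {i | i < j ∧ ∃ l', 7 ≤ i ∧ label₁ a b (i - 7) = l'} = Set.Ico 7 j := by
        ext i
        constructor
        · exact fun ⟨h, _, h', _⟩ => ⟨h', h⟩
        · exact fun h => ⟨h.2, _, h.1, rfl⟩
      rw [this, ← Finset.coe_Ico, Set.ncard_coe_finset, Nat.card_Ico]
    constructor
    · rintro rfl
      exact ⟨k + 7, ⟨by omega, by simp⟩, by rw [hcard]; omega⟩
    · rintro ⟨j, ⟨-, rfl⟩, hk⟩
      rw [hcard] at hk
      rw [hk]

theorem behavior_mem {a b : Val} (ha : a ≠ 0) (hb : b ≠ 0) :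
    behavior a b ∈ (mcsClient false a b).behTF :=
  ⟨run a b, run_isRun ha hb, run_threadFair a b, run_induces a b⟩

theorem not_finite (a b : Val) : ¬ (behavior a b).Finite := by
  intro h
  obtain ⟨k, hk⟩ := h 1
  have hk' : (behavior a b 1).get? k = none := hk
  rw [behavior_get?] at hk'
  cases hk'

/-! The execution graph: the hand-over precedes the initialization of the node in the modification
order. -/

/-- The events of the behavior. -/
inductive Occurs (a b : Val) : Event Mode Mode → Prop
  | init (x) : Occurs a b (.init x)
  | set₀ : Occurs a b (.act 0 0 (.W .rlx (.locked a) 1))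
  | clear₀ : Occurs a b (.act 1 0 (.W .rlx (.next a) 0))
  | swap₀ : Occurs a b (.act 2 0 (.U .acqrel .lock 0 a))
  | rel₀ : Occurs a b (.act 3 0 (.F .rel))
  | read₀ : Occurs a b (.act 4 0 (.R .rlx (.next a) b))
  | acq₀ : Occurs a b (.act 5 0 (.F .acq))
  | handOver₀ : Occurs a b (.act 6 0 (.W .rlx (.locked b) 0))
  | set₁ : Occurs a b (.act 0 1 (.W .rlx (.locked b) 1))
  | clear₁ : Occurs a b (.act 1 1 (.W .rlx (.next b) 0))
  | swap₁ : Occurs a b (.act 2 1 (.U .acqrel .lock a b))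
  | link₁ : Occurs a b (.act 3 1 (.W .rlx (.next a) b))
  | spin₁ (k) : Occurs a b (.act (k + 4) 1 (.R .rlx (.locked b) 1))

theorem mem_events {a b : Val} {e : Event Mode Mode} :
    e ∈ (behavior a b).events ↔ Occurs a b e := by
  constructor
  · rintro (⟨x, rfl⟩ | ⟨k, τ, l, h, rfl⟩)
    · exact .init x
    · rw [behavior_get?] at h
      by_cases hτ : τ = 0
      · subst hτ
        rw [if_pos rfl] at h
        split_ifs at h with hk
        cases h
        interval_cases k <;> constructor
      · obtain rfl : τ = 1 := Tid.eq_of_ne hτ (by decide)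
        rw [if_neg hτ] at h
        cases h
        match k with
        | 0 | 1 | 2 | 3 => constructor
        | k + 4 => exact .spin₁ k
  · intro h
    cases h
    case init x => exact Or.inl ⟨x, rfl⟩
    all_goals exact Or.inr ⟨_, _, _, rfl, rfl⟩

/-- The writes with their location, value and index in the modification order. -/
inductive Write (a b : Val) : Event Mode Mode → Loc → Val → ℕ → Prop
  | init (x) : Write a b (.init x) x 0 0
  | set₀ : Write a b (.act 0 0 (.W .rlx (.locked a) 1)) (.locked a) 1 1
  | clear₀ : Write a b (.act 1 0 (.W .rlx (.next a) 0)) (.next a) 0 1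
  | swap₀ : Write a b (.act 2 0 (.U .acqrel .lock 0 a)) .lock a 1
  | handOver₀ : Write a b (.act 6 0 (.W .rlx (.locked b) 0)) (.locked b) 0 1
  | set₁ : Write a b (.act 0 1 (.W .rlx (.locked b) 1)) (.locked b) 1 2
  | clear₁ : Write a b (.act 1 1 (.W .rlx (.next b) 0)) (.next b) 0 1
  | swap₁ : Write a b (.act 2 1 (.U .acqrel .lock a b)) .lock b 2
  | link₁ : Write a b (.act 3 1 (.W .rlx (.next a) b)) (.next a) b 2

/-- The reads with their location and value, and the index of their source in the modification
order. -/
inductive Read (a b : Val) : Event Mode Mode → Loc → Val → ℕ → Prop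
  | swap₀ : Read a b (.act 2 0 (.U .acqrel .lock 0 a)) .lock 0 0
  | read₀ : Read a b (.act 4 0 (.R .rlx (.next a) b)) (.next a) b 2
  | swap₁ : Read a b (.act 2 1 (.U .acqrel .lock a b)) .lock a 1
  | spin₁ (k) : Read a b (.act (k + 4) 1 (.R .rlx (.locked b) 1)) (.locked b) 1 2

variable {a b : Val}

theorem Write.occurs {w : Event Mode Mode} {x : Loc} {v : Val} {p : ℕ} (h : Write a b w x v p) :
    Occurs a b w ∧ w.IsW ∧ w.loc = some x ∧ w.valw = some v := by
  cases h <;> exact ⟨by constructor, trivial, rfl, rfl⟩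

theorem Read.occurs {r : Event Mode Mode} {x : Loc} {v : Val} {p : ℕ} (h : Read a b r x v p) :
    Occurs a b r ∧ r.IsR ∧ r.loc = some x ∧ r.valr = some v := by
  cases h <;> exact ⟨by constructor, trivial, rfl, rfl⟩

theorem Write.index_eq {w : Event Mode Mode} {x x' : Loc} {v v' : Val} {p p' : ℕ}
    (h : Write a b w x v p) (h' : Write a b w x' v' p') : p = p' := by
  cases h <;> cases h' <;> rfl

theorem Read.index_eq {r : Event Mode Mode} {x x' : Loc} {v v' : Val} {p p' : ℕ}
    (h : Read a b r x v p) (h' : Read a b r x' v' p') : p = p' := by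
  cases h <;> cases h' <;> rfl

/-- Distinctness of the nodes matters here: for equal nodes the two clearings, for example, would
share location and index. -/
theorem Write.eq_of_index (hab : a ≠ b) {w w' : Event Mode Mode} {x : Loc} {v v' : Val} {p : ℕ}
    (h : Write a b w x v p) (h' : Write a b w' x v' p) : w = w' := by
  cases h <;> cases h' <;> first | rfl | exact absurd rfl hab

theorem exists_write {w : Event Mode Mode} (h : Occurs a b w) (hw : w.IsW) :
    ∃ x v p, Write a b w x v p := by
  cases h <;> first | exact ⟨_, _, _, by constructor⟩ | exact hw.elim

theorem exists_read {r : Event Mode Mode} (h : Occurs a b r) (hr : r.IsR) :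
    ∃ w x v p, Write a b w x v p ∧ Read a b r x v p := by
  cases h
  case swap₀ => exact ⟨_, _, _, _, .init _, .swap₀⟩
  case read₀ => exact ⟨_, _, _, _, .link₁, .read₀⟩
  case swap₁ => exact ⟨_, _, _, _, .swap₀, .swap₁⟩
  case spin₁ k => exact ⟨_, _, _, _, .set₁, .spin₁ k⟩
  all_goals exact hr.elim

/-- The execution graph. -/
def graph (hab : a ≠ b) : ExecGraph Mode Mode where
  E := (behavior a b).events
  rf w r := ∃ x v p, Write a b w x v p ∧ Read a b r x v p
  mo w w' := ∃ x v v' p p', Write a b w x v p ∧ Write a b w' x v' p' ∧ p < p'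
  init_mem x := Or.inl ⟨x, rfl⟩
  sn_unique k τ l l' h h' := by
    have hmem : ∀ l, Event.act k τ l ∈ (behavior a b).events → (behavior a b τ).get? k = some l := by
      rintro l (⟨x, h⟩ | ⟨k', τ', l', h, h'⟩)
      · cases h
      · cases h'; exact h
    exact Option.some.inj ((hmem l h).symm.trans (hmem l' h'))
  sn_closed k τ l h j hj := by
    rcases h with ⟨x, h⟩ | ⟨k', τ', l', h, h'⟩
    · cases h
    · cases h'
      obtain ⟨l', hl'⟩ := Stream'.Seq.ge_stable (behavior a b τ) hj.le h
      exact ⟨l', Or.inr ⟨j, τ, l', hl', rfl⟩⟩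
  rf_dom := by
    rintro w r ⟨x, v, p, hw, hr⟩
    have h := hw.occurs
    have h' := hr.occurs
    exact ⟨mem_events.mpr h.1, mem_events.mpr h'.1, h.2.1, h'.2.1, h.2.2.1.trans h'.2.2.1.symm,
      h.2.2.2.trans h'.2.2.2.symm⟩
  rf_functional := by
    rintro w w' r ⟨x, v, p, hw, hr⟩ ⟨x', v', p', hw', hr'⟩
    obtain rfl : x = x' := Option.some.inj (hr.occurs.2.2.1.symm.trans hr'.occurs.2.2.1)
    obtain rfl := hr.index_eq hr'
    exact hw.eq_of_index hab hw'
  rf_total r h hr := by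
    obtain ⟨w, x, v, p, h⟩ := exists_read (mem_events.mp h) hr
    exact ⟨w, x, v, p, h⟩
  mo_dom := by
    rintro w r ⟨x, v, v', p, p', hw, hr, -⟩
    have h := hw.occurs
    have h' := hr.occurs
    exact ⟨mem_events.mpr h.1, mem_events.mpr h'.1, h.2.1, h'.2.1, h.2.2.1.trans h'.2.2.1.symm⟩
  mo_irrefl := by
    rintro w ⟨x, v, v', p, p', h, h', hlt⟩
    exact hlt.ne (h.index_eq h')
  mo_trans := by
    rintro w₁ w₂ w₃ ⟨x, v, v', p, p', h₁, h₂, hlt⟩ ⟨y, u, u', q, q', h₂', h₃, hlt'⟩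
    obtain rfl : x = y := Option.some.inj (h₂.occurs.2.2.1.symm.trans h₂'.occurs.2.2.1)
    obtain rfl := h₂.index_eq h₂'
    exact ⟨x, v, u', p, q', h₁, h₃, hlt.trans hlt'⟩
  mo_total w hw w' hw' hW hW' hl hne := by
    obtain ⟨x, v, p, h⟩ := exists_write (mem_events.mp hw) hW
    obtain ⟨x', v', p', h'⟩ := exists_write (mem_events.mp hw') hW'
    obtain rfl : x = x' := Option.some.inj (h.occurs.2.2.1.symm.trans (hl.trans h'.occurs.2.2.1))
    rcases lt_trichotomy p p' with hp | rfl | hp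
    · exact Or.inl ⟨x, v, v', p, p', h, h', hp⟩
    · exact absurd (h.eq_of_index hab h') hne
    · exact Or.inr ⟨x, v', v, p', p, h', h, hp⟩

/-- A rank that increases along `po` and `rf`. -/
def time : Event Mode Mode → ℕ
  | .init _ => 0
  -- The underlying interleaving: thread 0 up to its swap (times 1 to 3), thread 1 up to its link (4
  -- to 7), then the rest of thread 0 from 8 on. Its read of `next`, at time 9, thus follows the
  -- link.
  | .act k τ _ => if τ = 0 then (if k ≤ 2 then k + 1 else k + 5) else k + 4

/-- A rank that increases along `rf`, `mo` and `fr`. -/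
def coherenceRank : Event Mode Mode → ℕ
  | .init _ => 0
  | .act 0 0 _ => 2
  | .act 1 0 _ => 2
  | .act 2 0 _ => 2
  | .act 4 0 _ => 5
  | .act 6 0 _ => 2
  | .act 0 1 _ => 4
  | .act 1 1 _ => 2
  | .act 2 1 _ => 4
  | .act 3 1 _ => 4
  | .act _ _ _ => 5

theorem Write.coherenceRank_eq {w : Event Mode Mode} {x : Loc} {v : Val} {p : ℕ}
    (h : Write a b w x v p) : coherenceRank w = 2 * p := by
  cases h <;> rfl

/-- A plain read is placed strictly between its source and the next write. A read-modify-write is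
itself the next write, which is atomicity. -/
theorem Read.coherenceRank_eq {r : Event Mode Mode} {x : Loc} {v : Val} {p : ℕ}
    (h : Read a b r x v p) : coherenceRank r = 2 * p + 1 ∨
      (coherenceRank r = 2 * p + 2 ∧ ∃ v', Write a b r x v' (p + 1)) := by
  cases h
  · exact Or.inr ⟨rfl, _, .swap₀⟩
  · exact Or.inl rfl
  · exact Or.inr ⟨rfl, _, .swap₁⟩
  · exact Or.inl (by simp [coherenceRank])

/-! ### Monotonicity of the two ranks -/

variable {hab : a ≠ b}

theorem time_lt_of_po {e e' : Event Mode Mode} (h : (graph hab).po e e') : time e < time e' := by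
  have h := h.2.2
  rcases e with x | ⟨j, τ, l⟩ <;> rcases e' with x' | ⟨k, π, l'⟩
  · exact h.elim
  · simp only [time]
    split_ifs <;> omega
  · exact h.elim
  · obtain ⟨rfl, h⟩ := h
    simp only [time]
    split_ifs <;> omega

theorem time_lt_of_rf {e e' : Event Mode Mode} (h : (graph hab).rf e e') : time e < time e' := by
  obtain ⟨x, v, p, hw, hr⟩ := h
  cases hr <;> cases hw <;> simp [time]

theorem eco_rank {e e' : Event Mode Mode} (h : (graph hab).eco e e') :
    coherenceRank e < coherenceRank e' ∧ Occurs a b e ∧ Occurs a b e' ∧ e.loc = e'.loc ∧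
      e.loc ≠ none := by
  have base : ∀ {e e'}, ((graph hab).rf e e' ∨ (graph hab).mo e e' ∨ (graph hab).fr e e') →
      coherenceRank e < coherenceRank e' ∧ Occurs a b e ∧ Occurs a b e' ∧ e.loc = e'.loc ∧
        e.loc ≠ none := by
    rintro e e' (⟨x, v, p, hw, hr⟩ | ⟨x, v, v', p, p', hw, hw', hlt⟩ |
      ⟨⟨w, ⟨x, v, p, hw, hr⟩, y, u, u', q, q', hw', hw'', hlt⟩, hne⟩)
    · have h1 := hw.occurs
      have h2 := hr.occurs
      refine ⟨?_, h1.1, h2.1, by rw [h1.2.2.1, h2.2.2.1], by simp [h1.2.2.1]⟩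
      rw [hw.coherenceRank_eq]
      rcases hr.coherenceRank_eq with h | ⟨h, -⟩ <;> omega
    · have h1 := hw.occurs
      have h2 := hw'.occurs
      refine ⟨?_, h1.1, h2.1, by rw [h1.2.2.1, h2.2.2.1], by simp [h1.2.2.1]⟩
      rw [hw.coherenceRank_eq, hw'.coherenceRank_eq]
      omega
    · have h1 := hr.occurs
      have h2 := hw''.occurs
      obtain rfl : x = y := Option.some.inj (hw.occurs.2.2.1.symm.trans hw'.occurs.2.2.1)
      obtain rfl := hw.index_eq hw'
      refine ⟨?_, h1.1, h2.1, by rw [h1.2.2.1, h2.2.2.1], by simp [h1.2.2.1]⟩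
      rw [hw''.coherenceRank_eq]
      rcases hr.coherenceRank_eq with h | ⟨h, v', hv⟩
      · omega
      -- The write of index `p + 1` is the read-modify-write itself, which the definition of `fr`
      -- excludes.
      · have : p + 1 ≠ q' := by
          rintro rfl
          exact hne (hv.eq_of_index hab hw'')
        omega
  induction h with
  | single h => exact base h
  | tail _ h ih =>
    have h := base h
    exact ⟨ih.1.trans h.1, ih.2.1, h.2.2.1, ih.2.2.2.1.trans h.2.2.2.1, ih.2.2.2.2⟩

theorem time_le_of_rs {e e' : Event Mode Mode} (h : (graph hab).rs e e') : time e ≤ time e' := by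
  obtain ⟨_, ⟨rfl, -⟩, e₂, h₂, _, ⟨rfl, -⟩, h₃⟩ := h
  have h2 : time e ≤ time e₂ := by
    cases h₂ with
    | refl => exact le_rfl
    | single h => exact (time_lt_of_po h.1).le
  have h3 : time e₂ ≤ time e' := by
    clear h2 h₂
    induction h₃ with
    | refl => exact le_rfl
    | tail _ h ih =>
      obtain ⟨_, h, rfl, -⟩ := h
      exact ih.trans (time_lt_of_rf h).le
  exact h2.trans h3

theorem time_lt_of_sw {e e' : Event Mode Mode} (h : (graph hab).sw e e') : time e < time e' := by
  obtain ⟨_, ⟨rfl, -⟩, e₁, h₁, e₂, h₂, e₃, h₃, _, ⟨rfl, -⟩, e₄, h₄, rfl, -⟩ := h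
  have h1 : time e ≤ time e₁ := by
    cases h₁ with
    | refl => exact le_rfl
    | single h =>
      obtain ⟨_, ⟨rfl, -⟩, h⟩ := h
      exact (time_lt_of_po h).le
  have h4 : time e₃ ≤ time e₄ := by
    cases h₄ with
    | refl => exact le_rfl
    | single h =>
      obtain ⟨_, h, rfl, -⟩ := h
      exact (time_lt_of_po h).le
  have h2 := time_le_of_rs h₂
  have h3 := time_lt_of_rf h₃
  omega

/-- The swap of thread 1 synchronizes with nothing. -/
theorem not_sw_swap₁ {e' : Event Mode Mode} :
    ¬ (graph hab).sw (.act 2 1 (.U .acqrel .lock a b)) e' := by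
  rintro ⟨_, ⟨rfl, -⟩, e₁, h₁, e₂, ⟨_, ⟨rfl, -⟩, e₄, h₄, _, ⟨rfl, hW, -⟩, h₅⟩, e₃, h₃, -⟩
  have hno : ∀ r, ¬ (graph hab).rf (.act 2 1 (.U .acqrel .lock a b)) r := by
    rintro r ⟨x, v, p, hw, hr⟩
    cases hw
    cases hr
  cases h₁ with
  | single h =>
    obtain ⟨_, ⟨rfl, h⟩, -⟩ := h
    exact h
  | refl =>
    -- Thread 1 does not access the lock after its swap, so the release sequence cannot move along
    -- program order, and no read takes its value from this swap.
    have h4 : e₄ = .act 2 1 (.U .acqrel .lock a b) := by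
      cases h₄ with
      | refl => rfl
      | single h =>
        obtain ⟨⟨-, hE, hsb⟩, x, hx, hx'⟩ := h
        cases hx
        have ho := mem_events.mp hE
        cases ho <;> first | exact hsb.elim | cases hx'
        · exact absurd hsb.2 (by omega)
        · exact absurd hsb.2 (by omega)
    subst h4
    rcases ReflTransGen.cases_head h₅ with rfl | ⟨_, ⟨_, h, -⟩, -⟩
    · exact hno _ h₃
    · exact hno _ h

/-- An upper bound of happens-before. -/
def Before : Event Mode Mode → Event Mode Mode → Prop
  | .init _, .act _ _ _ => True
  | .act j τ _, .act k π _ => (τ = π ∧ j < k) ∨ (τ = 0 ∧ π = 1 ∧ j ≤ 2 ∧ 2 ≤ k)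
  | _, _ => False

theorem Before.trans {e₁ e₂ e₃ : Event Mode Mode} (h : Before e₁ e₂) (h' : Before e₂ e₃) :
    Before e₁ e₃ := by
  cases e₁ <;> cases e₂ <;> cases e₃ <;> simp only [Before] at h h' ⊢
  rcases h with ⟨rfl, h⟩ | ⟨rfl, rfl, h⟩ <;> rcases h' with ⟨rfl, h'⟩ | ⟨h1, rfl, h'⟩
  · exact Or.inl ⟨rfl, by omega⟩
  · exact Or.inr ⟨h1, rfl, by omega⟩
  · exact Or.inr ⟨rfl, rfl, by omega⟩
  · exact absurd h1 (by decide)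

theorem occurs_of_sw {e e' : Event Mode Mode} (h : (graph hab).sw e e') :
    Occurs a b e ∧ e.mode.AtLeastRel := by
  obtain ⟨_, ⟨rfl, hr⟩, e₁, h₁, e₂, ⟨_, ⟨rfl, -⟩, e₄, h₄, _, ⟨rfl, hW, -⟩, h₅⟩, e₃, h₃, -⟩ := h
  refine ⟨mem_events.mp ?_, hr⟩
  cases h₁ with
  | single h =>
    obtain ⟨_, ⟨rfl, -⟩, h⟩ := h
    exact h.1
  | refl =>
    cases h₄ with
    | single h => exact h.1.1
    | refl =>
      rcases ReflTransGen.cases_head h₅ with rfl | ⟨_, ⟨_, h, -⟩, -⟩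
      · exact ((graph hab).rf_dom _ _ h₃).1
      · exact ((graph hab).rf_dom _ _ h).1

theorem occurs_of_hb {e e' : Event Mode Mode} (h : (graph hab).hb e e') : Occurs a b e := by
  obtain ⟨e', h | h, -⟩ := TransGen.head'_iff.mp h
  · exact mem_events.mp h.1
  · exact (occurs_of_sw h).1

/-- The release events other than the swap of thread 1 are the swap and the release fence of thread
0. Comparing times leaves only edges inside thread 0 and the edge between the two swaps. -/
theorem before_of_sw {e e' : Event Mode Mode} (h : (graph hab).sw e e') : Before e e' := by
  have ht := time_lt_of_sw h
  have hn : ∀ l, e = .act 2 1 l → l ≠ .U .acqrel .lock a b := by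
    rintro _ rfl rfl
    exact not_sw_swap₁ h
  have hE := occurs_of_sw h
  have hE' : Occurs a b e' ∧ e'.mode.AtLeastAcq := by
    obtain ⟨_, -, e₁, -, e₂, -, e₃, h₃, _, ⟨rfl, -⟩, e₄, h₄, rfl, ha⟩ := h
    refine ⟨mem_events.mp ?_, ha⟩
    cases h₄ with
    | refl => exact ((graph hab).rf_dom _ _ h₃).2.1
    | single h =>
      obtain ⟨_, h, rfl, -⟩ := h
      exact h.2.1
  clear h
  obtain ⟨hE, hm⟩ := hE
  obtain ⟨hE', hm'⟩ := hE'
  have key : e = .act 2 0 (.U .acqrel .lock 0 a) ∨ e = .act 3 0 (.F .rel) := by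
    cases hE
    case swap₀ => exact Or.inl rfl
    case rel₀ => exact Or.inr rfl
    case swap₁ => exact absurd rfl (hn _ rfl)
    all_goals simp [Event.mode, Mode.AtLeastRel] at hm
  have key' : e' = .act 2 0 (.U .acqrel .lock 0 a) ∨ e' = .act 5 0 (.F .acq) ∨
      e' = .act 2 1 (.U .acqrel .lock a b) := by
    cases hE'
    case swap₀ => exact Or.inl rfl
    case acq₀ => exact Or.inr (Or.inl rfl)
    case swap₁ => exact Or.inr (Or.inr rfl)
    all_goals simp [Event.mode, Mode.AtLeastAcq] at hm'
  clear hE hE' hn hm hm'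
  rcases key with rfl | rfl <;> rcases key' with rfl | rfl | rfl <;> simp [time, Before] at ht ⊢

theorem before_of_hb {e e' : Event Mode Mode} (h : (graph hab).hb e e') : Before e e' := by
  have base : ∀ {e e'}, ((graph hab).po e e' ∨ (graph hab).sw e e') → Before e e' := by
    rintro e e' (h | h)
    · have h := h.2.2
      cases e <;> cases e' <;> simp only [Event.SB] at h <;> simp only [Before]
      exact Or.inl h
    · exact before_of_sw h
  induction h with
  | single h => exact base h
  | tail _ h ih => exact ih.trans (base h)

theorem Before.irrefl (e : Event Mode Mode) : ¬ Before e e := by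
  cases e
  · exact id
  · rintro (⟨-, h⟩ | ⟨h, h', -⟩)
    · exact lt_irrefl _ h
    · exact absurd (h.symm.trans h') (by decide)

/-- This is where the missing fence counts: `b.locked := 1` is not `Before` the hand-over, although
its rank is larger. A weak inequality suffices for coherence, because `eco` increases the rank
strictly. -/
theorem Before.coherenceRank_le (hab : a ≠ b) {e e' : Event Mode Mode} (h : Before e e')
    (he : Occurs a b e) (he' : Occurs a b e') (hl : e.loc = e'.loc) (hx : e.loc ≠ none) :
    coherenceRank e ≤ coherenceRank e' := by
  have hba := hab.symm
  cases he
  case init => exact Nat.zero_le _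
  all_goals
    cases he' <;> simp [Event.loc, Lab.loc, hab, hba] at hl hx <;>
      simp [Before, coherenceRank] at h ⊢

/-! ### RC11 consistency and fairness of the graph -/

theorem not_sc {e : Event Mode Mode} (h : Occurs a b e) : e.mode ≠ .sc := by
  cases h <;> simp [Event.mode]

theorem graph_RC11 : (graph hab).RC11 where
  coherence := by
    rintro e ⟨e', hb, heco⟩
    have hB := before_of_hb hb
    cases heco with
    | refl => exact Before.irrefl _ hB
    | single heco =>
      obtain ⟨hlt, he', he, hl, hx⟩ := eco_rank heco
      exact absurd (hB.coherenceRank_le hab he he' hl.symm (hl ▸ hx)) (not_le.mpr hlt)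
  atomicity e h := lt_irrefl _ (eco_rank h).1
  sc_order := by
    have hscb : ∀ {e e'}, (graph hab).scb e e' → Occurs a b e := by
      rintro e e' (h | ⟨_, h, -⟩ | h | h | h)
      · exact mem_events.mp h.1
      · exact mem_events.mp h.1.1
      · exact occurs_of_hb h.1
      · exact mem_events.mp ((graph hab).mo_dom _ _ h).1
      · exact (eco_rank (.single (Or.inr (Or.inr h)))).2.1
    -- Each such edge would start at an event of mode `sc`, and the graph has none, so the SC
    -- condition is vacuous.
    have hpsc : ∀ {e e'}, ¬ ((graph hab).pscBase e e' ∨ (graph hab).pscF e e') := by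
      rintro e e' (⟨m, ⟨rfl, h⟩ | ⟨_, ⟨rfl, -, h⟩, h'⟩, _, h'', -⟩ | ⟨_, ⟨rfl, -, h⟩, _, h', -⟩)
      · exact not_sc (hscb h'') h
      · cases h' with
        | refl => exact not_sc (hscb h'') h
        | single h' => exact not_sc (occurs_of_hb h') h
      · rcases h' with h' | ⟨_, h', -⟩ <;> exact not_sc (occurs_of_hb h') h
    intro e h
    obtain ⟨e', h, -⟩ := TransGen.head'_iff.mp h
    exact hpsc h
  no_thin_air := by
    have hlt : ∀ {e e'}, TransGen (fun e e' => (graph hab).po e e' ∨ (graph hab).rf e e') e e' →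
        time e < time e' := by
      intro e e' h
      induction h with
      | single h => exact h.elim time_lt_of_po time_lt_of_rf
      | tail _ h ih => exact ih.trans (h.elim time_lt_of_po time_lt_of_rf)
    exact fun e h => lt_irrefl _ (hlt h)

theorem graph_fair : (graph hab).Fair := by
  constructor
  · intro e _
    -- There are infinitely many initialization writes, but only the one at the location of `e` can
    -- be an `mo`-predecessor. The default location plays no role, since an event with an
    -- `mo`-predecessor has a location.
    refine Set.Finite.subset (Set.toFinite {.init (e.loc.getD .lock),
      .act 0 0 (.W .rlx (.locked a) 1), .act 1 0 (.W .rlx (.next a) 0),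
      .act 2 0 (.U .acqrel .lock 0 a), .act 6 0 (.W .rlx (.locked b) 0),
      .act 0 1 (.W .rlx (.locked b) 1), .act 1 1 (.W .rlx (.next b) 0),
      .act 2 1 (.U .acqrel .lock a b), .act 3 1 (.W .rlx (.next a) b)}) ?_
    rintro w ⟨x, v, v', p, p', hw, hw', -⟩
    rw [hw'.occurs.2.2.1]
    clear hw'
    cases hw <;> simp
  · intro e _
    refine Set.Finite.subset (Set.toFinite {.act 2 0 (.U .acqrel .lock 0 a),
      .act 4 0 (.R .rlx (.next a) b), .act 2 1 (.U .acqrel .lock a b)}) ?_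
    rintro r ⟨⟨w, ⟨x, v, p, hw, hr⟩, y, u, u', q, q', hw', hw'', hlt⟩, -⟩
    obtain rfl := hw.index_eq hw'
    -- No index exceeds 2, and the spinning reads have a source of index 2. Hence they have no
    -- `fr`-successor, and only three reads remain.
    have hq : q' ≤ 2 := by
      cases hw'' <;> omega
    clear hw hw' hw''
    cases hr
    case spin₁ => omega
    all_goals simp

end Unfenced

end FairMem

theorem theorem5p5 (a b : FairMem.Val) (ha : a ≠ 0) (hb : b ≠ 0) (hab : a ≠ b) :
    -- with the release fence, under fair SC, TSO and RA
    (∀ (i : FairMem.FenceReading) (β : FairMem.Behavior Unit Empty),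
      β ∈ ((FairMem.mcsClient true a b).plain i).behTF →
        (β ∈ FairMem.behDecl (fun G => G.SC ∧ G.Fair) → β.Finite) ∧
        (β ∈ FairMem.behDecl (fun G => G.TSO ∧ G.Fair) → β.Finite) ∧
        (β ∈ FairMem.behDecl (fun G => G.RA ∧ G.Fair) → β.Finite)) ∧
    -- with the release fence, under fair RC11
    (∀ β : FairMem.Behavior FairMem.Mode FairMem.Mode,
      β ∈ (FairMem.mcsClient true a b).behTF →
        β ∈ FairMem.behDecl (fun G => G.RC11 ∧ G.Fair) → β.Finite) ∧
    -- without the release fence, some thread-fair behavior under fair RC11 is infinite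
    (∃ β : FairMem.Behavior FairMem.Mode FairMem.Mode,
      β ∈ (FairMem.mcsClient false a b).behTF ∧
        β ∈ FairMem.behDecl (fun G => G.RC11 ∧ G.Fair) ∧ ¬ β.Finite) := by
  refine ⟨fun i β h => ⟨?_, ?_, ?_⟩, fun β h => FairMem.finite_of_RC11 ha hb hab h,
    FairMem.Unfenced.behavior a b, FairMem.Unfenced.behavior_mem ha hb,
    ⟨FairMem.Unfenced.graph hab, ⟨FairMem.Unfenced.graph_RC11, FairMem.Unfenced.graph_fair⟩, rfl⟩,
    FairMem.Unfenced.not_finite a b⟩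
  · exact FairMem.finite_of_plain ha hb hab h fun _ => FairMem.ExecGraph.SC.sync
  · exact FairMem.finite_of_plain ha hb hab h fun _ => FairMem.ExecGraph.TSO.sync
  · exact FairMem.finite_of_plain ha hb hab h fun _ => FairMem.ExecGraph.RA.sync
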